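/- For a finite simple graph $H$, let $r(H)$ denote the diagonal Ramsey number of $H$, that is, the minimum $N$ such that every coloring of the edges of the complete graph $K_N$ with two colors contains a monochromatic copy of $H$ (as a not necessarily induced subgraph). For a positive integer $n$, let $F_n$ be the fan formed by $n$ triangles that share exactly one common vertex, all their other vertices being distinct; thus $F_n$ has $2n+1$ vertices. Then, for every positive integer $n$, \[ \frac{9n}{2} - 5 \;\le\; r(F_n) \;\le\; \frac{11n}{2} + 6 . \] -/

import Mathlib

open scoped SimpleGraph

/-- The fan `F_n`: `n` triangles sharing exactly one vertex, the center `none`. The `i`-th triangle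
has vertices `none`, `some (i, 0)` and `some (i, 1)`. -/
def fan (n : ℕ) : SimpleGraph (Option (Fin n × Fin 2)) where
  Adj x y := x ≠ y ∧
    (x = none ∨ y = none ∨ ∃ (i : Fin n) (a b : Fin 2), x = some (i, a) ∧ y = some (i, b))
  symm := ⟨by
    rintro x y ⟨hne, h⟩
    refine ⟨hne.symm, ?_⟩
    rcases h with h | h | ⟨i, a, b, hx, hy⟩
    · exact Or.inr (Or.inl h)
    · exact Or.inl h
    · exact Or.inr (Or.inr ⟨i, b, a, hy, hx⟩)⟩
  loopless := ⟨fun _ h => h.1 rfl⟩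

/-- The set of all `N` such that every red-blue coloring of the edges of `K_N` (red is `0`, blue is
`1`) yields a red copy of `H₁` or a blue copy of `H₂`. -/
def ramseySet {α β : Type*} (H₁ : SimpleGraph α) (H₂ : SimpleGraph β) : Set ℕ :=
  {N | ∀ C : SimpleGraph.TopEdgeLabeling (Fin N) (Fin 2),
    H₁ ⊑ C.labelGraph 0 ∨ H₂ ⊑ C.labelGraph 1}

/-- The Ramsey number `r(H₁, H₂)`: the minimum of `ramseySet H₁ H₂`. -/
noncomputable def ramseyNumber {α β : Type*} (H₁ : SimpleGraph α) (H₂ : SimpleGraph β) : ℕ :=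
  sInf (ramseySet H₁ H₂)

/-- The diagonal Ramsey number `r(H) = r(H, H)`. -/
noncomputable def diagRamseyNumber {α : Type*} (H : SimpleGraph α) : ℕ :=
  ramseyNumber H H

/-! A graph contains `fan n` exactly when some neighbourhood contains `n` disjoint edges. Otherwise
the Tutte–Berge formula gives, for each `v`, a set `X` in the neighbourhood of `v` such that the
rest has at least `deg v + |X| + 2 - 2n` components, recorded as labels (`NbrSplit`). Vertices with
different labels are adjacent in the complement, so the labels form a complete multipartite graph of
the other colour, and representatives form a clique. A multipartite graph lying in a neighbourhood
of its own colour carries a single label there once two of its parts survive the removal of `X`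
(`eq_of_multipartite`), and is then small (`card_le_of_one_label`). The upper bound plays these
facts in the two colours against each other.

Upper bound: take `N = ⌊11n/2⌋ + 6` vertices with no fan in either colour. All degrees are below
`3n` (`card_nbr_lt`). If neither colour has a clique on `3n/2` vertices, a neighbourhood of large
degree is dominated by one label, vertices off that label again have large degree, and averaging
gives a contradiction (`not_large_degree_of_no_large_clique`). If `Q` is a maximum clique with at
least `3n/2` vertices, every `u` in `Q` has many neighbours outside `Q` that see little of `Q`. A
weighted count yields such a `t` with at least `3n/10` neighbours in `Q`; splitting the
complementary neighbourhood of `t` isolates a part of `Q` on which a second count fails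
(`not_large_clique`).

Lower bound: three cliques on `2m` vertices, joined cyclically by sparse regular bipartite graphs,
with `m` close to `3n/4` (`partGraph`). -/

/-! ### Disjoint edges and the Tutte–Berge formula -/

/-- The join of `G` with a complete graph on `κ`. -/
def joinComplete {W : Type*} (G : SimpleGraph W) (κ : Type*) : SimpleGraph (W ⊕ κ) where
  Adj x y := x ≠ y ∧ ∀ a b, x = Sum.inl a → y = Sum.inl b → G.Adj a b
  symm := ⟨fun _ _ h => ⟨h.1.symm, fun a b ha hb => (h.2 b a hb ha).symm⟩⟩
  loopless := ⟨fun _ h => h.1 rfl⟩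

/-- A fixed-point-free involution along edges of `G` on a set of `2 * n` vertices yields `n`
disjoint edges. -/
theorem exists_disjoint_edges_of_involution {W : Type*} [Fintype W] [DecidableEq W]
    (G : SimpleGraph W) (n : ℕ) (A : Finset W) (p : W → W) (hA : 2 * n ≤ A.card)
    (hp : ∀ a ∈ A, p a ∈ A ∧ p (p a) = a ∧ G.Adj a (p a)) :
    ∃ e : Fin n × Fin 2 → W, Function.Injective e ∧ ∀ i, G.Adj (e (i, 0)) (e (i, 1)) := by
  classical
  let r : W → ℕ := fun w => (Fintype.equivFin W w : ℕ)
  have hr : Function.Injective r := fun a b h =>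
    (Fintype.equivFin W).injective (Fin.ext h)
  -- An arbitrary linear order selects the lower endpoint of each pair; `p` exchanges `L` and `U`,
  -- so `L` is half of `A`.
  let L := A.filter fun a => r a < r (p a)
  let U := A.filter fun a => r (p a) < r a
  have hLU : L.card = U.card := by
    refine Finset.card_bij' (fun a _ => p a) (fun a _ => p a) ?_ ?_ ?_ ?_
    · intro a ha
      obtain ⟨h1, h2⟩ := Finset.mem_filter.1 ha
      obtain ⟨h3, h4, _⟩ := hp a h1
      exact Finset.mem_filter.2 ⟨h3, by rwa [h4]⟩
    · intro a ha
      obtain ⟨h1, h2⟩ := Finset.mem_filter.1 ha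
      obtain ⟨h3, h4, _⟩ := hp a h1
      exact Finset.mem_filter.2 ⟨h3, by rwa [h4]⟩
    · intro a ha
      exact (hp a (Finset.mem_filter.1 ha).1).2.1
    · intro a ha
      exact (hp a (Finset.mem_filter.1 ha).1).2.1
  have hcov : A ⊆ L ∪ U := by
    intro a ha
    have hne : r a ≠ r (p a) := fun h => (hp a ha).2.2.ne (hr h)
    rcases lt_or_gt_of_ne hne with h | h
    · exact Finset.mem_union_left _ (Finset.mem_filter.2 ⟨ha, h⟩)
    · exact Finset.mem_union_right _ (Finset.mem_filter.2 ⟨ha, h⟩)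
  have hcard : n ≤ L.card := by
    have h1 := Finset.card_le_card hcov
    have h2 := Finset.card_union_le L U
    omega
  obtain ⟨g⟩ : Nonempty (Fin n ↪ L) :=
    Function.Embedding.nonempty_of_card_le (by simpa using hcard)
  have hg : ∀ i, (g i : W) ∈ A ∧ r (g i) < r (p (g i)) := fun i => Finset.mem_filter.1 (g i).2
  refine ⟨fun x => if x.2 = 0 then g x.1 else p (g x.1), ?_, ?_⟩
  · have hpp : ∀ i, p (p (g i)) = g i := fun i => (hp _ (hg i).1).2.1
    have key : ∀ i j, (g i : W) ≠ p (g j) := by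
      intro i j h
      have h1 := (hg i).2
      have h2 := (hg j).2
      rw [h, hpp] at h1
      omega
    rintro ⟨i, a⟩ ⟨j, b⟩ h
    have hinj : ∀ i j, (g i : W) = g j → i = j := fun i j h => g.injective (Subtype.ext h)
    fin_cases a <;> fin_cases b <;> simp only [Fin.zero_eta, Fin.mk_one, Fin.isValue, if_true,
      one_ne_zero, if_false] at h ⊢
    · rw [hinj _ _ h]
    · exact (key _ _ h).elim
    · exact (key _ _ h.symm).elim
    · have : (g i : W) = g j := by rw [← hpp i, h, hpp j]
      rw [hinj _ _ this]
  · intro i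
    simpa using (hp _ (hg i).1).2.2

/-- The `k` added vertices absorb at most `k` vertices of `W`; the remaining `2 * n` or more are
matched among themselves. -/
theorem exists_disjoint_edges_of_isPerfectMatching {W : Type*} [Fintype W] [DecidableEq W]
    (G : SimpleGraph W) (n k : ℕ) (hk : 2 * n + k ≤ Fintype.card W)
    (M : (joinComplete G (Fin k)).Subgraph) (hM : M.IsPerfectMatching) :
    ∃ e : Fin n × Fin 2 → W, Function.Injective e ∧ ∀ i, G.Adj (e (i, 0)) (e (i, 1)) := by
  classical
  rw [SimpleGraph.Subgraph.isPerfectMatching_iff] at hM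
  choose q hq hq' using hM
  have hqq : ∀ x, q (q x) = x := fun x => (hq' (q x) x (hq x).symm).symm
  let A : Finset W := Finset.univ.filter fun w => ∃ w', q (Sum.inl w) = Sum.inl w'
  let p : W → W := fun w => if h : ∃ w', q (Sum.inl w) = Sum.inl w' then h.choose else w
  have hpA : ∀ w ∈ A, q (Sum.inl w) = Sum.inl (p w) := by
    intro w hw
    have h := (Finset.mem_filter.1 hw).2
    simp only [p, dif_pos h]
    exact h.choose_spec
  have hcompl : Aᶜ.card ≤ k := by
    have : ∀ w ∈ Aᶜ, ∃ j : Fin k, q (Sum.inl w) = Sum.inr j := by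
      intro w hw
      rcases h : q (Sum.inl w) with w' | j
      · exact absurd (Finset.mem_filter.2 ⟨Finset.mem_univ _, w', h⟩) (Finset.mem_compl.1 hw)
      · exact ⟨j, rfl⟩
    have h1 : ((Finset.univ : Finset (Fin k)).map (Function.Embedding.inr (α := W))).card = k := by
      simp
    rw [← h1]
    refine Finset.card_le_card_of_injOn (fun w => q (Sum.inl w)) ?_ ?_
    · intro w hw
      obtain ⟨j, hj⟩ := this w hw
      simp [hj]
    · intro a _ b _ h2
      have h3 := congrArg q h2
      simp only [hqq] at h3
      exact Sum.inl_injective h3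
  refine exists_disjoint_edges_of_involution G n A p ?_ ?_
  · have := Finset.card_add_card_compl A
    omega
  · intro a ha
    have h1 := hpA a ha
    have h2 : q (Sum.inl (p a)) = Sum.inl a := by rw [← h1, hqq]
    have h3 : p a ∈ A := Finset.mem_filter.2 ⟨Finset.mem_univ _, a, h2⟩
    refine ⟨h3, Sum.inl_injective (β := Fin k) ?_, ?_⟩
    · rw [← hpA _ h3, h2]
    · have := M.adj_sub (hq (Sum.inl a))
      exact this.2 _ _ rfl h1

/-- The deficiency form of Tutte's theorem: a graph without `n` disjoint edges has a set `X` whose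
removal leaves many components; these are recorded by the labels `f`. -/
theorem exists_labels_of_no_disjoint_edges {W : Type*} [Fintype W] [DecidableEq W]
    (G : SimpleGraph W) (n : ℕ) (hn : 0 < n)
    (hG : ¬ ∃ e : Fin n × Fin 2 → W, Function.Injective e ∧ ∀ i, G.Adj (e (i, 0)) (e (i, 1))) :
    ∃ (X : Finset W) (f : W → ℕ), (∀ a b, a ∉ X → b ∉ X → G.Adj a b → f a = f b) ∧
      Fintype.card W + X.card + 2 ≤ (Xᶜ.image f).card + 2 * n := by
  classical
  by_cases hW : Fintype.card W < 2 * n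
  -- With fewer than `2 * n` vertices one constant label suffices; `0 < n` covers the empty `W`,
  -- which has no label at all.
  · refine ⟨∅, fun _ => 0, fun _ _ _ _ _ => rfl, ?_⟩
    rcases isEmpty_or_nonempty W with h | ⟨⟨w⟩⟩
    · simp; omega
    · have : 0 < (((∅ : Finset W)ᶜ).image fun _ => 0).card :=
        Finset.card_pos.2 ⟨0, Finset.mem_image.2 ⟨w, by simp, rfl⟩⟩
      simp only [Finset.card_empty]
      omega
  push Not at hW
  obtain ⟨k, hk⟩ := Nat.exists_eq_add_of_le hW
  let G' := joinComplete G (Fin k)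
  have hno : ¬ ∃ M : G'.Subgraph, M.IsPerfectMatching := fun ⟨M, hM⟩ =>
    hG (exists_disjoint_edges_of_isPerfectMatching G n k hk.ge M hM)
  rw [SimpleGraph.tutte] at hno
  push Not at hno
  obtain ⟨u, hu⟩ := hno
  unfold SimpleGraph.IsTutteViolator at hu
  set K := ((⊤ : G'.Subgraph).deleteVerts u).coe with hK
  have hmem : ∀ x, x ∈ ((⊤ : G'.Subgraph).deleteVerts u).verts ↔ x ∉ u := by simp
  have hadj : ∀ x y, K.Adj x y ↔ G'.Adj x y := by
    intro x y
    have hx := (hmem x).1 x.2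
    have hy := (hmem y).1 y.2
    simp [hK, hx, hy]
  have hcardV : Nat.card ((⊤ : G'.Subgraph).deleteVerts u).verts + u.ncard
      = Fintype.card W + k := by
    have h1 : ((⊤ : G'.Subgraph).deleteVerts u).verts = uᶜ := by ext x; simp
    rw [h1, Nat.card_coe_set_eq, add_comm, Set.ncard_add_ncard_compl]
    simp
  have hpar := SimpleGraph.odd_ncard_oddComponents (G := K)
  -- The order `2 * n + 2 * k` is even, so the number of odd components has the parity of `u`; the
  -- excess of at least 1 in Tutte's condition is therefore at least 2.
  have hle : u.ncard + 2 ≤ K.oddComponents.ncard := by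
    rcases Nat.lt_or_ge (u.ncard + 1) K.oddComponents.ncard with h | h
    · exact h
    · have h2 : K.oddComponents.ncard = u.ncard + 1 := by omega
      rw [h2, Nat.odd_iff, Nat.odd_iff] at hpar
      omega
  have hcc : K.oddComponents.ncard ≤ Nat.card K.ConnectedComponent := by
    rw [← Set.ncard_univ]
    exact Set.ncard_le_ncard (Set.subset_univ _)
  -- An added vertex left outside `u` would be adjacent to everything, leaving a single component.
  have hinr : ∀ j : Fin k, Sum.inr j ∈ u := by
    intro j
    by_contra hj
    have hconn : ∀ c d : K.ConnectedComponent, c = d := by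
      have hc : ∀ c : K.ConnectedComponent,
          c = K.connectedComponentMk ⟨Sum.inr j, (hmem _).2 hj⟩ := by
        intro c
        induction c using SimpleGraph.ConnectedComponent.ind with
        | h v =>
          rw [SimpleGraph.ConnectedComponent.eq]
          by_cases hv : v = ⟨Sum.inr j, (hmem _).2 hj⟩
          · rw [hv]
          · refine SimpleGraph.Adj.reachable ((hadj _ _).2 ⟨?_, ?_⟩)
            · exact fun h => hv (Subtype.ext h)
            · intro a b _ hb
              simp at hb
      intro c d
      rw [hc c, hc d]
    have : Subsingleton K.ConnectedComponent := ⟨hconn⟩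
    have h3 : Nat.card K.ConnectedComponent ≤ 1 := Finite.card_le_one_iff_subsingleton.2 this
    omega
  obtain ⟨g, hg⟩ := Countable.exists_injective_nat K.ConnectedComponent
  let X : Finset W := Finset.univ.filter fun w => Sum.inl w ∈ u
  have hXmem : ∀ w, w ∉ X ↔ (Sum.inl w : W ⊕ Fin k) ∉ u := by simp [X]
  let f : W → ℕ := fun w => if h : (Sum.inl w : W ⊕ Fin k) ∉ u then
    g (K.connectedComponentMk ⟨Sum.inl w, (hmem _).2 h⟩) else 0
  have hf : ∀ w (h : (Sum.inl w : W ⊕ Fin k) ∉ u),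
      f w = g (K.connectedComponentMk ⟨Sum.inl w, (hmem _).2 h⟩) := fun w h => dif_pos h
  have hXcard : X.card + k = u.ncard := by
    have h1 : u = ((X.disjSum (Finset.univ : Finset (Fin k)) : Finset (W ⊕ Fin k)) :
        Set (W ⊕ Fin k)) := by
      ext x
      rcases x with w | j
      · simp [X]
      · simp [hinr j]
    rw [h1, Set.ncard_coe_finset, Finset.card_disjSum]
    simp
  refine ⟨X, f, ?_, ?_⟩
  · intro a b ha hb hab
    rw [hXmem] at ha hb
    rw [hf a ha, hf b hb]
    congr 1
    rw [SimpleGraph.ConnectedComponent.eq]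
    refine SimpleGraph.Adj.reachable ((hadj _ _).2 ⟨?_, ?_⟩)
    · exact fun h => hab.ne (Sum.inl_injective h)
    · intro a' b' ha' hb'
      rwa [← Sum.inl_injective ha', ← Sum.inl_injective hb']
  · have h1 : Nat.card K.ConnectedComponent ≤ (Xᶜ.image f).card := by
      rw [← Set.ncard_univ, ← Set.ncard_image_of_injective _ hg, ← Set.ncard_coe_finset]
      refine Set.ncard_le_ncard ?_ (Finset.finite_toSet _)
      rintro _ ⟨c, -, rfl⟩
      induction c using SimpleGraph.ConnectedComponent.ind with
      | h v =>
        obtain ⟨v, hv⟩ := v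
        have hv' := (hmem _).1 hv
        rcases v with w | j
        · refine Finset.mem_coe.2 (Finset.mem_image.2 ⟨w, ?_, hf w hv'⟩)
          rw [Finset.mem_compl, hXmem]
          exact hv'
        · exact absurd (hinr j) hv'
    omega

/-! ### Splittings of neighbourhoods -/

open Classical in
/-- The neighbours of `v` in `G`, as a finset. -/
noncomputable def nbr {V : Type*} [Fintype V] (G : SimpleGraph V) (v : V) : Finset V :=
  Finset.univ.filter (G.Adj v)

@[simp]
theorem mem_nbr {V : Type*} [Fintype V] {G : SimpleGraph V} {v w : V} :
    w ∈ nbr G v ↔ G.Adj v w := by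
  simp [nbr]

/-- The labelled decomposition of the neighbourhood of `v` in a graph in which this neighbourhood
has no `n` disjoint edges: after removing `X`, adjacent vertices have equal labels. -/
structure NbrSplit {V : Type*} [Fintype V] [DecidableEq V] (G : SimpleGraph V) (n : ℕ) (v : V) where
  X : Finset V
  f : V → ℕ
  subset : X ⊆ nbr G v
  eq_of_adj : ∀ a ∈ nbr G v \ X, ∀ b ∈ nbr G v \ X, G.Adj a b → f a = f b
  card_le : (nbr G v).card + X.card + 2 ≤ ((nbr G v \ X).image f).card + 2 * n

theorem fan_isContained_of_disjoint_edges {V : Type*} (G : SimpleGraph V) (n : ℕ) (v : V)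
    (e : Fin n × Fin 2 → V) (he : Function.Injective e) (hv : ∀ x, G.Adj v (e x))
    (hadj : ∀ i, G.Adj (e (i, 0)) (e (i, 1))) : fan n ⊑ G := by
  refine ⟨⟨⟨fun x => x.elim v e, ?_⟩, ?_⟩⟩
  · rintro x y ⟨hne, h⟩
    rcases x with _ | x <;> rcases y with _ | y
    · exact absurd rfl hne
    · exact hv y
    · exact (hv x).symm
    · rcases h with h | h | ⟨i, a, b, ha, hb⟩
      · simp at h
      · simp at h
      · rw [Option.some_inj] at ha hb
        subst ha hb
        fin_cases a <;> fin_cases b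
        · exact absurd rfl hne
        · exact hadj i
        · exact (hadj i).symm
        · exact absurd rfl hne
  · rintro (_ | x) (_ | y) h
    · rfl
    · exact absurd h (hv y).ne
    · exact absurd h (hv x).ne'
    · exact congrArg some (he h)

theorem nonempty_nbrSplit {V : Type*} [Fintype V] [DecidableEq V] (G : SimpleGraph V) (n : ℕ) (hn : 0 < n)
    (hG : ¬ fan n ⊑ G) (v : V) : Nonempty (NbrSplit G n v) := by
  obtain ⟨X, f, hf, hcard⟩ := exists_labels_of_no_disjoint_edges
    (W := {x // x ∈ nbr G v}) (G.comap Subtype.val) n hn (by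
      rintro ⟨e, he, hadj⟩
      exact hG (fan_isContained_of_disjoint_edges G n v (fun x => e x)
        (Subtype.val_injective.comp he) (fun x => mem_nbr.1 (e x).2) hadj))
  refine ⟨⟨X.map (Function.Embedding.subtype _),
    fun x => if h : x ∈ nbr G v then f ⟨x, h⟩ else 0, ?_, ?_, ?_⟩⟩
  · intro x hx
    obtain ⟨y, -, rfl⟩ := Finset.mem_map.1 hx
    exact y.2
  · intro a ha b hb hab
    rw [Finset.mem_sdiff] at ha hb
    simp only [dif_pos ha.1, dif_pos hb.1]
    refine hf _ _ ?_ ?_ hab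
    · exact fun h => ha.2 (Finset.mem_map.2 ⟨_, h, rfl⟩)
    · exact fun h => hb.2 (Finset.mem_map.2 ⟨_, h, rfl⟩)
  · rw [Finset.card_map]
    have h1 : Xᶜ.image f ⊆ (nbr G v \ X.map (Function.Embedding.subtype _)).image
        (fun x => if h : x ∈ nbr G v then f ⟨x, h⟩ else 0) := by
      intro y hy
      obtain ⟨x, hx, rfl⟩ := Finset.mem_image.1 hy
      refine Finset.mem_image.2 ⟨x, Finset.mem_sdiff.2 ⟨x.2, ?_⟩, dif_pos x.2⟩
      intro h
      obtain ⟨z, hz, hzx⟩ := Finset.mem_map.1 h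
      rw [Finset.mem_compl] at hx
      exact hx (by rwa [← Subtype.ext hzx])
    have h2 := Finset.card_le_card h1
    have h3 : Fintype.card {x // x ∈ nbr G v} = (nbr G v).card :=
      Fintype.card_coe _
    omega

namespace NbrSplit

variable {V : Type*} [Fintype V] [DecidableEq V] {G : SimpleGraph V} {n : ℕ} {v : V}

/-- The part of the neighbourhood that carries meaningful labels. -/
noncomputable def T (s : NbrSplit G n v) : Finset V := nbr G v \ s.X

/-- The number of labels in use. -/
noncomputable def k (s : NbrSplit G n v) : ℕ := (s.T.image s.f).card

theorem mem_T (s : NbrSplit G n v) {a : V} : a ∈ s.T ↔ G.Adj v a ∧ a ∉ s.X := by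
  simp [T]

theorem card_T (s : NbrSplit G n v) : s.T.card + s.X.card = (nbr G v).card :=
  Finset.card_sdiff_add_card_eq_card s.subset

theorem le_k (s : NbrSplit G n v) : (nbr G v).card + s.X.card + 2 ≤ s.k + 2 * n := s.card_le

theorem k_le_card_T (s : NbrSplit G n v) : s.k ≤ s.T.card := Finset.card_image_le

theorem card_X_lt (s : NbrSplit G n v) : s.X.card + 1 ≤ n := by
  have h1 := s.card_T
  have h2 := s.le_k
  have h3 := s.k_le_card_T
  omega

/-- If a set `A` of neighbours uses only one label, then `A` is small. -/
theorem card_le_of_one_label (s : NbrSplit G n v) {A : Finset V} (hA : A ⊆ nbr G v) (c : ℕ)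
    (hc : ∀ a ∈ A, a ∉ s.X → s.f a = c) : s.X.card + A.card + 1 ≤ 2 * n := by
  -- `A` accounts for at most one label, and each vertex outside `s.X ∪ A` for at most one more.
  have h1 : s.T.image s.f ⊆ insert c ((nbr G v \ (s.X ∪ A)).image s.f) := by
    intro y hy
    obtain ⟨x, hx, rfl⟩ := Finset.mem_image.1 hy
    rw [mem_T] at hx
    by_cases hxA : x ∈ A
    · exact Finset.mem_insert.2 (Or.inl (hc x hxA hx.2))
    · refine Finset.mem_insert.2 (Or.inr (Finset.mem_image_of_mem _ ?_))
      simp [hx.1, hx.2, hxA]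
  have h2 := Finset.card_le_card h1
  have h3 := Finset.card_insert_le c ((nbr G v \ (s.X ∪ A)).image s.f)
  have h4 := Finset.card_image_le (s := nbr G v \ (s.X ∪ A)) (f := s.f)
  have h5 := Finset.card_sdiff_add_card_eq_card (Finset.union_subset s.subset hA)
  have h6 : A.card ≤ (s.X ∪ A).card := Finset.card_le_card Finset.subset_union_right
  have h7 := s.le_k
  unfold k at h7
  omega

/-- A complete multipartite set with at least two parts carries a single label. -/
theorem eq_of_multipartite (s : NbrSplit G n v) {A : Finset V} (hA : A ⊆ s.T) (f : V → ℕ)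
    (hf : ∀ a ∈ A, ∀ b ∈ A, f a ≠ f b → G.Adj a b) {p q : V} (hp : p ∈ A) (hq : q ∈ A)
    (hpq : f p ≠ f q) : ∀ a ∈ A, s.f a = s.f p := by
  have key : ∀ a ∈ A, ∀ b ∈ A, f a ≠ f b → s.f a = s.f b := fun a ha b hb hab =>
    s.eq_of_adj a (hA ha) b (hA hb) (hf a ha b hb hab)
  intro a ha
  by_cases h : f a = f p
  -- Two vertices of the same part are compared through a vertex of another part.
  · rw [key a ha q hq (h ▸ hpq), key p hp q hq hpq]
  · exact key a ha p hp h

theorem k_le_image_filter (s : NbrSplit G n v) (c : ℕ) :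
    s.k ≤ ((s.T.filter fun a => s.f a ≠ c).image s.f).card + 1 := by
  have h1 : s.T.image s.f ⊆ insert c ((s.T.filter fun a => s.f a ≠ c).image s.f) := by
    intro y hy
    obtain ⟨x, hx, rfl⟩ := Finset.mem_image.1 hy
    by_cases h : s.f x = c
    · exact Finset.mem_insert.2 (Or.inl h)
    · exact Finset.mem_insert.2 (Or.inr (Finset.mem_image_of_mem _ (Finset.mem_filter.2 ⟨hx, h⟩)))
  exact (Finset.card_le_card h1).trans (Finset.card_insert_le _ _)

theorem k_le_filter (s : NbrSplit G n v) (c : ℕ) :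
    s.k ≤ (s.T.filter fun a => s.f a ≠ c).card + 1 :=
  (s.k_le_image_filter c).trans (Nat.add_le_add_right Finset.card_image_le 1)

theorem k_le_filter_filter (s : NbrSplit G n v) (c l : ℕ) :
    s.k ≤ (s.T.filter fun a => s.f a ≠ c ∧ s.f a ≠ l).card + 2 := by
  have h1 : s.T.image s.f ⊆
      insert c (insert l ((s.T.filter fun a => s.f a ≠ c ∧ s.f a ≠ l).image s.f)) := by
    intro y hy
    obtain ⟨x, hx, rfl⟩ := Finset.mem_image.1 hy
    by_cases h : s.f x = c
    · exact Finset.mem_insert.2 (Or.inl h)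
    by_cases h' : s.f x = l
    · exact Finset.mem_insert.2 (Or.inr (Finset.mem_insert.2 (Or.inl h')))
    · exact Finset.mem_insert.2 (Or.inr (Finset.mem_insert.2 (Or.inr
        (Finset.mem_image_of_mem _ (Finset.mem_filter.2 ⟨hx, h, h'⟩)))))
  have h2 := Finset.card_le_card h1
  have h3 := Finset.card_insert_le c
    (insert l ((s.T.filter fun a => s.f a ≠ c ∧ s.f a ≠ l).image s.f))
  have h4 := Finset.card_insert_le l ((s.T.filter fun a => s.f a ≠ c ∧ s.f a ≠ l).image s.f)
  have h5 := Finset.card_image_le (s := s.T.filter fun a => s.f a ≠ c ∧ s.f a ≠ l) (f := s.f)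
  unfold k
  omega

end NbrSplit

/-! ### Complementary pairs and the degree bound -/

/-- Two complementary graphs in which all neighbourhoods can be split. -/
structure ComplPair {V : Type*} [Fintype V] [DecidableEq V] (G H : SimpleGraph V) (n : ℕ) : Prop where
  adj_or : ∀ a b, a ≠ b → G.Adj a b ∨ H.Adj a b
  not_both : ∀ a b, G.Adj a b → ¬ H.Adj a b
  split_left : ∀ v, Nonempty (NbrSplit G n v)
  split_right : ∀ v, Nonempty (NbrSplit H n v)

namespace ComplPair

variable {V : Type*} [Fintype V] [DecidableEq V] {G H : SimpleGraph V} {n : ℕ}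

theorem symm (P : ComplPair G H n) : ComplPair H G n :=
  ⟨fun a b h => (P.adj_or a b h).symm, fun a b h h' => P.not_both a b h' h,
    P.split_right, P.split_left⟩

theorem card_nbr_add (P : ComplPair G H n) (v : V) :
    (nbr G v).card + (nbr H v).card + 1 = Fintype.card V := by
  have h1 : Disjoint (nbr G v) (nbr H v) := by
    rw [Finset.disjoint_left]
    intro a ha hb
    exact P.not_both _ _ (mem_nbr.1 ha) (mem_nbr.1 hb)
  have h2 : nbr G v ∪ nbr H v = Finset.univ.erase v := by
    ext a
    simp only [Finset.mem_union, mem_nbr, Finset.mem_erase, Finset.mem_univ, and_true]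
    constructor
    · rintro (h | h)
      · exact h.ne'
      · exact h.ne'
    · exact fun h => P.adj_or _ _ h.symm
  have h3 : 0 < Fintype.card V := Fintype.card_pos_iff.2 ⟨v⟩
  rw [← Finset.card_union_of_disjoint h1, h2, Finset.card_erase_of_mem (Finset.mem_univ _),
    Finset.card_univ]
  omega

theorem adj_of_ne_label (P : ComplPair G H n) {v : V} (s : NbrSplit G n v) {a b : V}
    (ha : a ∈ s.T) (hb : b ∈ s.T) (hab : s.f a ≠ s.f b) : H.Adj a b := by
  rcases P.adj_or a b (fun h => hab (congrArg _ h)) with h | h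
  · exact absurd (s.eq_of_adj a ha b hb h) hab
  · exact h

/-- Representatives of the labels form a clique in the complementary graph. -/
theorem exists_clique (P : ComplPair G H n) {v : V} (s : NbrSplit G n v) {A : Finset V}
    (hA : A ⊆ s.T) : ∃ R ⊆ A, H.IsClique (R : Set V) ∧ R.card = (A.image s.f).card := by
  obtain ⟨R, hRA, hinj, himg⟩ := Finset.exists_subset_injOn_image_eq_of_surjOn (f := s.f) A
    (A.image s.f) (by intro y hy; simpa using hy)
  refine ⟨R, by exact_mod_cast hRA, ?_, ?_⟩
  · intro a ha b hb hab
    exact P.adj_of_ne_label s (hA (hRA ha)) (hA (hRA hb)) fun h => hab (hinj ha hb h)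
  · rw [← himg, Finset.card_image_of_injOn hinj]

/-- Either the labelled part is small, or a single label covers almost all of it. -/
theorem dichotomy (P : ComplPair G H n) {v : V} (s : NbrSplit G n v) {l : ℕ}
    (hl : l ∈ s.T.image s.f) :
    s.T.card + 1 ≤ 2 * n + (s.T.filter fun a => s.f a = l).card ∨
    ∃ c, s.k ≤ n + 1 ∧ (s.T.filter fun a => s.f a ≠ c).card + 1
      ≤ n + (s.T.filter fun a => s.f a = l).card := by
  obtain ⟨u, hu, rfl⟩ := Finset.mem_image.1 hl
  obtain ⟨s'⟩ := P.split_right u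
  set A := s.T.filter fun a => s.f a ≠ s.f u with hAdef
  have hAcard := Finset.card_filter_add_card_filter_not (s := s.T) (fun a => s.f a = s.f u)
  change _ + A.card = _ at hAcard
  have hAu : A ⊆ nbr H u := by
    intro a ha
    obtain ⟨h1, h2⟩ := Finset.mem_filter.1 ha
    exact mem_nbr.2 (P.adj_of_ne_label s hu h1 (Ne.symm h2))
  -- `A` is complete multipartite in `H` and lies in the `H`-neighbourhood of `u`. Either two parts
  -- survive outside `s'.X`, and `A` carries one label of `s'`; or all parts but one, `c`, lie
  -- inside `s'.X`, which has fewer than `n` vertices.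
  by_cases hA : ∃ p ∈ A \ s'.X, ∃ q ∈ A \ s'.X, s.f p ≠ s.f q
  · left
    obtain ⟨p, hp, q, hq, hpq⟩ := hA
    have hsub : A \ s'.X ⊆ s'.T := Finset.sdiff_subset_sdiff hAu le_rfl
    have h1 := s'.eq_of_multipartite hsub s.f (fun a ha b hb hab =>
      P.adj_of_ne_label s (Finset.mem_filter.1 (Finset.mem_sdiff.1 ha).1).1
        (Finset.mem_filter.1 (Finset.mem_sdiff.1 hb).1).1 hab) hp hq hpq
    have h2 := s'.card_le_of_one_label hAu (s'.f p) fun a ha ha' =>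
      h1 a (Finset.mem_sdiff.2 ⟨ha, ha'⟩)
    omega
  · right
    push Not at hA
    obtain ⟨c, hc⟩ : ∃ c, ∀ a ∈ A \ s'.X, s.f a = c := by
      rcases (A \ s'.X).eq_empty_or_nonempty with h | ⟨p, hp⟩
      · exact ⟨0, by simp [h]⟩
      · exact ⟨s.f p, fun a ha => hA a ha p hp⟩
    have hX := s'.card_X_lt
    have h1 : (s.T.filter fun a => s.f a ≠ c ∧ s.f a ≠ s.f u) ⊆ s'.X := by
      intro a ha
      obtain ⟨h1, h2, h3⟩ := Finset.mem_filter.1 ha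
      by_contra h4
      exact h2 (hc a (Finset.mem_sdiff.2 ⟨Finset.mem_filter.2 ⟨h1, h3⟩, h4⟩))
    have h2 := Finset.card_le_card h1
    have h3 := s.k_le_filter_filter c (s.f u)
    refine ⟨c, by omega, ?_⟩
    have h4 : (s.T.filter fun a => s.f a ≠ c) ⊆ (s.T.filter fun a => s.f a = s.f u) ∪
        (s.T.filter fun a => s.f a ≠ c ∧ s.f a ≠ s.f u) := by
      intro a ha
      obtain ⟨h1, h2⟩ := Finset.mem_filter.1 ha
      by_cases h : s.f a = s.f u <;> simp [h1, h2, h]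
    have h5 := (Finset.card_le_card h4).trans (Finset.card_union_le _ _)
    omega

/-- A degree of at least `3 * n` forces `s.k ≥ n + 2`, which rules out the second alternative of
`dichotomy`. The first, applied to a label class of size at most 2, contradicts the bounds on `s.X`
and `s.k`. -/
theorem card_nbr_lt (P : ComplPair G H n) (v : V) : (nbr G v).card + 1 ≤ 3 * n := by
  by_contra hd
  obtain ⟨s⟩ := P.split_left v
  have h1 := s.le_k
  have h2 := s.card_T
  have h3 := s.k_le_card_T
  have h4 : (s.T.image s.f).card = s.k := rfl
  rcases Nat.lt_or_ge s.T.card (s.k * 2) with h | h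
  · obtain ⟨l, hl, hlt⟩ := Finset.exists_card_fiber_lt_of_card_lt_mul (f := s.f)
      (s := s.T) (t := s.T.image s.f) (n := 2) (by rw [h4]; exact h)
    rcases P.dichotomy s hl with h | ⟨c, hk, hc⟩ <;> omega
  · obtain ⟨l, hl, hlt⟩ := Finset.exists_card_fiber_lt_of_card_lt_mul (f := s.f)
      (s := s.T) (t := s.T.image s.f) (n := 3) (by rw [h4]; omega)
    rcases P.dichotomy s hl with h | ⟨c, hk, hc⟩ <;> omega

theorem le_card_nbr (P : ComplPair G H n) (v : V) : Fintype.card V ≤ (nbr G v).card + 3 * n := by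
  have h1 := P.symm.card_nbr_lt v
  have h2 := P.card_nbr_add v
  omega

end ComplPair

/-! ### Existence of a large clique -/

/-- Counting the elements that are alone in their fibre. -/
theorem exists_subset_two_mul_card_image_le {α : Type*} [DecidableEq α] (A : Finset α) (f : α → ℕ) :
    ∃ S ⊆ A, (∀ a ∈ S, ∀ b ∈ A, f b = f a → b = a) ∧
      2 * (A.image f).card ≤ A.card + S.card := by
  set S := A.filter fun a => ∀ b ∈ A, f b = f a → b = a with hS
  set B := A.filter fun a => ¬ ∀ b ∈ A, f b = f a → b = a with hB
  have h1 : S.card + B.card = A.card := Finset.card_filter_add_card_filter_not _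
  have h2 : A.image f ⊆ S.image f ∪ B.image f := by
    intro y hy
    obtain ⟨a, ha, rfl⟩ := Finset.mem_image.1 hy
    by_cases h : ∀ b ∈ A, f b = f a → b = a
    · exact Finset.mem_union_left _ (Finset.mem_image_of_mem _ (Finset.mem_filter.2 ⟨ha, h⟩))
    · exact Finset.mem_union_right _ (Finset.mem_image_of_mem _ (Finset.mem_filter.2 ⟨ha, h⟩))
  have h3 := (Finset.card_le_card h2).trans (Finset.card_union_le _ _)
  have h4 := Finset.card_image_le (s := S) (f := f)
  have h5 : 2 * (B.image f).card ≤ B.card := by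
    refine Finset.mul_card_image_le_card _ _ fun y hy => ?_
    obtain ⟨a, ha, rfl⟩ := Finset.mem_image.1 hy
    obtain ⟨haA, hna⟩ := Finset.mem_filter.1 ha
    push Not at hna
    obtain ⟨b, hb, hfb, hba⟩ := hna
    have hbB : b ∈ B := Finset.mem_filter.2 ⟨hb, fun h => hba (h a haA hfb.symm).symm⟩
    exact Finset.one_lt_card.2 ⟨a, Finset.mem_filter.2 ⟨ha, rfl⟩, b,
      Finset.mem_filter.2 ⟨hbB, hfb⟩, hba.symm⟩
  exact ⟨S, Finset.filter_subset _ _, fun a ha => (Finset.mem_filter.1 ha).2, by omega⟩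

/-- Some `a ∈ S` is adjacent to at most the average number of vertices of `W`. -/
theorem exists_mul_card_inter_nbr_le {V : Type*} [Fintype V] [DecidableEq V] (H : SimpleGraph V)
    (S W : Finset V) (hS : S.Nonempty) (r : ℕ)
    (h : ∀ w ∈ W, 4 * (S ∩ nbr H w).card ≤ r) :
    ∃ a ∈ S, 4 * (S.card * (W ∩ nbr H a).card) ≤ W.card * r := by
  classical
  obtain ⟨a, ha, hmin⟩ := Finset.exists_min_image S (fun a => (W ∩ nbr H a).card) hS
  refine ⟨a, ha, ?_⟩
  have h1 : S.card * (W ∩ nbr H a).card ≤ ∑ b ∈ S, (W ∩ nbr H b).card := by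
    simpa using Finset.card_nsmul_le_sum S _ _ hmin
  have h2 : ∑ b ∈ S, (W ∩ nbr H b).card = ∑ w ∈ W, (S ∩ nbr H w).card := by
    have := Finset.sum_card_bipartiteAbove_eq_sum_card_bipartiteBelow (s := S) (t := W)
      (fun a b => H.Adj a b)
    convert this using 3 with b hb w hw
    · ext x; simp [Finset.bipartiteAbove]
    · ext x; simp [Finset.bipartiteBelow, H.adj_comm]
  have h3 : ∑ w ∈ W, 4 * (S ∩ nbr H w).card ≤ W.card * r := by
    simpa using Finset.sum_le_card_nsmul W _ _ h
  rw [← Finset.mul_sum] at h3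
  omega

/-- By `h1` and `h4`, `μ` is at most about `ω / 3`; by `h2` and `h3`, it is at least `ω - n / 2`,
which exceeds `ω / 3`. The additive constants make the contradiction strict. -/
theorem averaging_bound {n σ ω μ : ℕ} (h1 : 3 * n + 53 ≤ 4 * σ) (h2 : 3 * n + 13 ≤ 4 * ω)
    (h3 : 2 * ω + 7 ≤ 2 * μ + n) (h4 : 4 * (σ * μ) ≤ ω * (n + 1)) : False := by
  have h5 := Nat.mul_le_mul_right μ h1
  have h6 := Nat.mul_le_mul_left (3 * n + 53) h3
  have h7 := Nat.mul_le_mul_left (n + 26) h2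
  nlinarith

namespace ComplPair

variable {V : Type*} [Fintype V] [DecidableEq V] {G H : SimpleGraph V} {n : ℕ}

/-- Without large cliques, the neighbourhood of a vertex of large degree is dominated by a single
label. -/
theorem exists_dominant_label (P : ComplPair G H n) {v : V} (hv : 11 * n + 9 ≤ 4 * (nbr G v).card)
    (hH : ∀ R : Finset V, H.IsClique (R : Set V) → 2 * R.card < 3 * n) :
    ∃ (s : NbrSplit G n v) (c : ℕ), s.k ≤ n + 1 ∧
      (s.T.filter fun a => s.f a ≠ c).card ≤ n + 2 := by
  obtain ⟨s⟩ := P.split_left v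
  have h1 := s.le_k
  have h2 := s.card_T
  have h3 := s.k_le_card_T
  have h4 : (s.T.image s.f).card = s.k := rfl
  obtain ⟨l, hl, hlt⟩ := Finset.exists_card_fiber_lt_of_card_lt_mul (f := s.f)
    (s := s.T) (t := s.T.image s.f) (n := 4) (by rw [h4]; omega)
  rcases P.dichotomy s hl with h | ⟨c, hk, hc⟩
  -- The chosen class has at most 3 vertices, so here `s.T` has at most `2 * n + 2`. This makes
  -- `s.X`, and with it `s.k`, large: representatives form an `H`-clique on at least `3 * n / 2`
  -- vertices.
  · obtain ⟨R, -, hR, hcard⟩ := P.exists_clique s (le_refl s.T)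
    have := hH R hR
    omega
  · exact ⟨s, c, hk, by omega⟩

/-- The vertices `w` off the dominant label: the others among them with a different label are
removed in every splitting of the complementary neighbourhood of `w`. -/
theorem mem_X_of_off_dominant (P : ComplPair G H n) {v : V}
    (hv : 11 * n + 9 ≤ 4 * (nbr G v).card) (s : NbrSplit G n v) (c : ℕ) (hk : s.k ≤ n + 1)
    (hc : (s.T.filter fun a => s.f a ≠ c).card ≤ n + 2) {w : V} (hw : w ∈ s.T) (hwc : s.f w ≠ c)
    (s' : NbrSplit H n w) {a : V} (ha : a ∈ s.T) (hac : s.f a ≠ c) (haw : s.f a ≠ s.f w) :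
    a ∈ s'.X := by
  by_contra haX
  have h1 := s.le_k
  have h2 := s.card_T
  have h3 := s.k_le_filter_filter c (s.f w)
  have hX := s'.card_X_lt
  have h4 : (s.T.filter fun a => s.f a = s.f w).card
      + (s.T.filter fun a => s.f a ≠ c ∧ s.f a ≠ s.f w).card
      = (s.T.filter fun a => s.f a ≠ c).card := by
    rw [← Finset.card_filter_add_card_filter_not (s := s.T.filter fun a => s.f a ≠ c)
      (fun a => s.f a = s.f w), Finset.filter_filter, Finset.filter_filter]
    congr 2
    ext x
    simp only [Finset.mem_filter]
    constructor
    · rintro ⟨h, h'⟩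
      exact ⟨h, h' ▸ hwc, h'⟩
    · rintro ⟨h, -, h'⟩
      exact ⟨h, h'⟩
  set A := s.T.filter fun a => s.f a ≠ s.f w with hA
  have h5 : (s.T.filter fun a => s.f a = s.f w).card + A.card = s.T.card :=
    Finset.card_filter_add_card_filter_not _
  have h6 : (s.T.filter fun a => s.f a = c).card + (s.T.filter fun a => s.f a ≠ c).card
    = s.T.card := Finset.card_filter_add_card_filter_not _
  have hAw : A ⊆ nbr H w := by
    intro b hb
    obtain ⟨h1, h2⟩ := Finset.mem_filter.1 hb
    exact mem_nbr.2 (P.adj_of_ne_label s hw h1 (Ne.symm h2))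
  -- The dominant class is larger than `s'.X`. Together with `a`, a survivor `b` puts two parts
  -- outside `s'.X`, so `A` carries one label, which its size forbids.
  obtain ⟨b, hb, hbX⟩ : ∃ b ∈ s.T.filter fun a => s.f a = c, b ∉ s'.X :=
    Finset.exists_mem_notMem_of_card_lt_card (by omega)
  obtain ⟨hbT, hbc⟩ := Finset.mem_filter.1 hb
  have hsub : A \ s'.X ⊆ s'.T := Finset.sdiff_subset_sdiff hAw le_rfl
  have h7 := s'.eq_of_multipartite hsub s.f (fun a ha b hb hab =>
      P.adj_of_ne_label s (Finset.mem_filter.1 (Finset.mem_sdiff.1 ha).1).1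
        (Finset.mem_filter.1 (Finset.mem_sdiff.1 hb).1).1 hab)
      (p := a) (q := b) (Finset.mem_sdiff.2 ⟨Finset.mem_filter.2 ⟨ha, haw⟩, haX⟩)
      (Finset.mem_sdiff.2 ⟨Finset.mem_filter.2 ⟨hbT, hbc ▸ hwc.symm⟩, hbX⟩) (hbc ▸ hac)
  have h8 := s'.card_le_of_one_label hAw (s'.f a) fun x hx hx' =>
      h7 x (Finset.mem_sdiff.2 ⟨hx, hx'⟩)
  omega

/-- Vertices off the dominant label again have large degree in the same graph. -/
theorem le_card_nbr_of_off_dominant (P : ComplPair G H n)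
    (hN : 11 * n + 11 ≤ 2 * Fintype.card V)
    (hG : ∀ R : Finset V, G.IsClique (R : Set V) → 2 * R.card < 3 * n) {v : V}
    (hv : 11 * n + 9 ≤ 4 * (nbr G v).card) (s : NbrSplit G n v) (c : ℕ) (hk : s.k ≤ n + 1)
    (hc : (s.T.filter fun a => s.f a ≠ c).card ≤ n + 2) {w : V} (hw : w ∈ s.T)
    (hwc : s.f w ≠ c) : 11 * n + 9 ≤ 4 * (nbr G w).card := by
  by_contra hlt
  have hdeg := P.card_nbr_add w
  obtain ⟨s'⟩ := P.split_right w
  have h1 : (s.T.filter fun a => s.f a ≠ c ∧ s.f a ≠ s.f w) ⊆ s'.X := by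
    intro a ha
    obtain ⟨h1, h2, h3⟩ := Finset.mem_filter.1 ha
    exact P.mem_X_of_off_dominant hv s c hk hc hw hwc s' h1 h2 h3
  have h2 := Finset.card_le_card h1
  have h3 := s.k_le_filter_filter c (s.f w)
  have h4 := s.le_k
  have h5 := s'.le_k
  -- Both the `H`-degree of `w` and `s'.X`, which has at least `s.k - 2` vertices, are large, so
  -- `s'` has at least `3 * n / 2` labels.
  obtain ⟨R, -, hR, hcard⟩ := P.symm.exists_clique s' (le_refl s'.T)
  have h6 := hG R hR
  have h7 : (s'.T.image s'.f).card = s'.k := rfl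
  omega

/-- If `w` has a dominant label in `G`, a vertex `w'` off that label has few `H`-neighbours
among the `H`-neighbours of `w`. -/
theorem card_inter_nbr_le (P : ComplPair G H n)
    (hN : 11 * n + 11 ≤ 2 * Fintype.card V) (hN' : 2 * Fintype.card V ≤ 11 * n + 12)
    (hG : ∀ R : Finset V, G.IsClique (R : Set V) → 2 * R.card < 3 * n) {w : V}
    (hw : 11 * n + 9 ≤ 4 * (nbr G w).card) (s : NbrSplit G n w) (c : ℕ) (hk : s.k ≤ n + 1)
    (hc : (s.T.filter fun a => s.f a ≠ c).card ≤ n + 2) {w' : V} (hw' : w' ∈ s.T)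
    (hwc : s.f w' ≠ c) {C : Finset V} (hC : C ⊆ nbr H w) :
    4 * (C ∩ nbr H w').card ≤ n + 1 := by
  have h0 := P.le_card_nbr_of_off_dominant hN hG hw s c hk hc hw' hwc
  have hdeg := P.card_nbr_add w'
  have h1 := s.le_k
  have h2 := s.card_T
  have h3 := s.k_le_filter_filter c (s.f w')
  have h4 : (s.T.filter fun a => s.f a = s.f w').card
      + (s.T.filter fun a => s.f a ≠ c ∧ s.f a ≠ s.f w').card
      ≤ (s.T.filter fun a => s.f a ≠ c).card := by
    rw [← Finset.card_filter_add_card_filter_not (s := s.T.filter fun a => s.f a ≠ c)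
      (fun a => s.f a = s.f w'), Finset.filter_filter, Finset.filter_filter]
    refine Nat.add_le_add_right (Finset.card_le_card fun x hx => ?_) _
    obtain ⟨h, h'⟩ := Finset.mem_filter.1 hx
    exact Finset.mem_filter.2 ⟨h, h' ▸ hwc, h'⟩
  set A := s.T.filter fun a => s.f a ≠ s.f w' with hA
  have h5 : (s.T.filter fun a => s.f a = s.f w').card + A.card = s.T.card :=
    Finset.card_filter_add_card_filter_not _
  have h6 : Disjoint A (C ∩ nbr H w') := by
    rw [Finset.disjoint_left]
    intro a ha ha'
    have h7 := (s.mem_T.1 (Finset.mem_filter.1 ha).1).1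
    exact P.not_both _ _ h7 (mem_nbr.1 (hC (Finset.mem_inter.1 ha').1))
  have h7 : A ∪ (C ∩ nbr H w') ⊆ nbr H w' := by
    refine Finset.union_subset (fun a ha => ?_) Finset.inter_subset_right
    obtain ⟨h1, h2⟩ := Finset.mem_filter.1 ha
    exact mem_nbr.2 (P.adj_of_ne_label s hw' h1 (Ne.symm h2))
  -- The `H`-degree of `w'` is at most about `11 * n / 4`, and `A`, consisting of `G`-neighbours of
  -- `w`, already uses most of it.
  have h8 := Finset.card_le_card h7
  rw [Finset.card_union_of_disjoint h6] at h8
  omega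

/-- Let `C` be the dominant class at `v` and `w` a vertex off it. In the `H`-neighbourhood of `w`
the removed set lies largely outside `C`, so `C` meets many labels, many of them in a single vertex.
Averaging over these vertices gives one, `a`, with few `H`-neighbours in the off-dominant set `W` of
the `G`-neighbourhood of `w`. In the `G`-neighbourhood of `a`, most of `C` and of `W` then carry one
common label, and together they are too large. -/
theorem not_large_degree_of_no_large_clique (P : ComplPair G H n)
    (hN : 11 * n + 11 ≤ 2 * Fintype.card V) (hN' : 2 * Fintype.card V ≤ 11 * n + 12)
    (hG : ∀ R : Finset V, G.IsClique (R : Set V) → 2 * R.card < 3 * n)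
    (hH : ∀ R : Finset V, H.IsClique (R : Set V) → 2 * R.card < 3 * n) {v : V}
    (hv : 11 * n + 9 ≤ 4 * (nbr G v).card) : False := by
  obtain ⟨s, c, hk, hc⟩ := P.exists_dominant_label hv hH
  have hsk := s.le_k
  have hsT := s.card_T
  have hsW := s.k_le_filter c
  have hC : (s.T.filter fun a => s.f a = c).card + (s.T.filter fun a => s.f a ≠ c).card
    = s.T.card := Finset.card_filter_add_card_filter_not _
  set C := s.T.filter fun a => s.f a = c with hCdef
  obtain ⟨w, hw⟩ : (s.T.filter fun a => s.f a ≠ c).Nonempty := Finset.card_pos.1 (by omega)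
  obtain ⟨hwT, hwc⟩ := Finset.mem_filter.1 hw
  have hwbig := P.le_card_nbr_of_off_dominant hN hG hv s c hk hc hwT hwc
  obtain ⟨s₁⟩ := P.split_right w
  obtain ⟨s₂, c₂, hk₂, hc₂⟩ := P.exists_dominant_label hwbig hH
  have hCw : C ⊆ nbr H w := by
    intro a ha
    obtain ⟨h1, h2⟩ := Finset.mem_filter.1 ha
    exact mem_nbr.2 (P.adj_of_ne_label s hwT h1 (h2 ▸ hwc))
  -- the part of `s₁.X` outside `C` is large
  have hXo : s.k ≤ (s₁.X \ C).card + 2 := by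
    refine (s.k_le_filter_filter c (s.f w)).trans (Nat.add_le_add_right (Finset.card_le_card ?_) _)
    intro a ha
    obtain ⟨h1, h2, h3⟩ := Finset.mem_filter.1 ha
    refine Finset.mem_sdiff.2 ⟨P.mem_X_of_off_dominant hv s c hk hc hwT hwc s₁ h1 h2 h3, ?_⟩
    exact fun h => h2 (Finset.mem_filter.1 h).2
  have hXsplit := Finset.card_sdiff_add_card_inter s₁.X C
  have hX₁ := s₁.card_X_lt
  have hk₁ := s₁.le_k
  -- the number of labels of `s₁` on `C`
  set C' := C \ s₁.X with hC'
  have hC'card : C'.card + (s₁.X ∩ C).card = C.card := by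
    rw [Finset.inter_comm]
    exact Finset.card_sdiff_add_card_inter C s₁.X
  have hkC : s₁.X.card + 2 + C.card + (s₁.X \ C).card ≤ (C'.image s₁.f).card + 2 * n := by
    have h1 : s₁.T.image s₁.f ⊆ C'.image s₁.f ∪ (nbr H w \ (s₁.X ∪ C)).image s₁.f := by
      intro y hy
      obtain ⟨x, hx, rfl⟩ := Finset.mem_image.1 hy
      rw [NbrSplit.mem_T] at hx
      by_cases hxC : x ∈ C
      · exact Finset.mem_union_left _ (Finset.mem_image_of_mem _ (Finset.mem_sdiff.2 ⟨hxC, hx.2⟩))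
      · refine Finset.mem_union_right _ (Finset.mem_image_of_mem _ ?_)
        simp [hx.1, hx.2, hxC]
    have h2 := (Finset.card_le_card h1).trans (Finset.card_union_le _ _)
    have h3 := Finset.card_image_le (s := nbr H w \ (s₁.X ∪ C)) (f := s₁.f)
    have h4 := Finset.card_sdiff_add_card_eq_card (Finset.union_subset s₁.subset hCw)
    have h5 := Finset.card_sdiff_add_card s₁.X C
    have h6 : (s₁.T.image s₁.f).card = s₁.k := rfl
    omega
  obtain ⟨S, hSC', hSalone, hScard⟩ := exists_subset_two_mul_card_image_le C' s₁.f
  set W := s₂.T.filter fun a => s₂.f a ≠ c₂ with hW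
  have hk₂' := s₂.le_k
  have hWcard : s₂.k ≤ W.card + 1 := s₂.k_le_filter c₂
  have hfew : ∀ w' ∈ W, ∀ D ⊆ C, 4 * (D ∩ nbr H w').card ≤ n + 1 := by
    intro w' hw' D hD
    obtain ⟨h1, h2⟩ := Finset.mem_filter.1 hw'
    exact P.card_inter_nbr_le hN hN' hG hwbig s₂ c₂ hk₂ hc₂ h1 h2 (hD.trans hCw)
  have hC'C : C' ⊆ C := Finset.sdiff_subset
  have hC'T : C' ⊆ s₁.T := Finset.sdiff_subset_sdiff hCw le_rfl
  obtain ⟨a, haS, haW⟩ := exists_mul_card_inter_nbr_le H S W (Finset.card_pos.1 (by omega)) (n + 1)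
    fun w' hw' => hfew w' hw' S (hSC'.trans hC'C)
  have haC' := hSC' haS
  have haS' := hSalone a haS
  have hWC : ∀ x ∈ W, x ∉ C := by
    intro x hx hxC
    exact P.not_both _ _ (s₂.mem_T.1 (Finset.mem_filter.1 hx).1).1 (mem_nbr.1 (hCw hxC))
  -- the neighbourhood of `a` in `G`
  obtain ⟨s₃⟩ := P.split_left a
  have hX₃ := s₃.card_X_lt
  set B := C'.erase a with hB
  have hBcard : B.card + 1 = C'.card := Finset.card_erase_add_one haC'
  have hBadj : ∀ x ∈ C', ∀ y ∈ C', s₁.f x ≠ s₁.f y → G.Adj x y := fun x hx y hy hxy =>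
    P.symm.adj_of_ne_label s₁ (hC'T hx) (hC'T hy) hxy
  have hBa : B ⊆ nbr G a := by
    intro x hx
    obtain ⟨h1, h2⟩ := Finset.mem_erase.1 hx
    exact mem_nbr.2 (hBadj a haC' x h2 fun h => h1 (haS' x h2 h.symm))
  have hBT : B \ s₃.X ⊆ s₃.T := Finset.sdiff_subset_sdiff hBa le_rfl
  obtain ⟨p, hp, q, hq, hpq⟩ : ∃ p ∈ B \ s₃.X, ∃ q ∈ B \ s₃.X, s₁.f p ≠ s₁.f q := by
    -- Removing `a` and `s₃.X` from `C'` destroys at most `s₃.X.card + 1` labels, so at least two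
    -- remain.
    have h1 : C'.image s₁.f ⊆ (B \ s₃.X).image s₁.f ∪ (insert a s₃.X).image s₁.f := by
      rw [← Finset.image_union]
      refine Finset.image_subset_image fun x hx => ?_
      by_cases h1 : x = a
      · simp [h1]
      by_cases h2 : x ∈ s₃.X
      · simp [h2]
      · simp [hB, h1, h2, hx]
    have h2 := (Finset.card_le_card h1).trans (Finset.card_union_le _ _)
    have h3 := Finset.card_image_le (s := insert a s₃.X) (f := s₁.f)
    have h4 := Finset.card_insert_le a s₃.X
    obtain ⟨y, hy, z, hz, hyz⟩ := Finset.one_lt_card.1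
      (show 1 < ((B \ s₃.X).image s₁.f).card by omega)
    obtain ⟨p, hp, rfl⟩ := Finset.mem_image.1 hy
    obtain ⟨q, hq, rfl⟩ := Finset.mem_image.1 hz
    exact ⟨p, hp, q, hq, hyz⟩
  have hBlabel := s₃.eq_of_multipartite hBT s₁.f (fun x hx y hy =>
    hBadj x (Finset.mem_of_mem_erase (Finset.mem_sdiff.1 hx).1) y
      (Finset.mem_of_mem_erase (Finset.mem_sdiff.1 hy).1)) hp hq hpq
  have hBX : B.card ≤ (B \ s₃.X).card + s₃.X.card := by
    have := Finset.card_sdiff_add_card B s₃.X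
    have := Finset.card_le_card (Finset.subset_union_left (s₁ := B) (s₂ := s₃.X))
    omega
  have hWlabel : ∀ x ∈ W ∩ nbr G a, x ∉ s₃.X → s₃.f x = s₃.f p := by
    intro x hx hxX
    obtain ⟨hxW, hxa⟩ := Finset.mem_inter.1 hx
    have h1 := hfew x hxW (B \ s₃.X)
      ((Finset.sdiff_subset.trans (Finset.erase_subset _ _)).trans hC'C)
    -- `x` has at most `(n + 1) / 4` `H`-neighbours in `B \ s₃.X`, so a `G`-neighbour there passes
    -- its label on to `x`.
    obtain ⟨z, hz, hzx⟩ : ∃ z ∈ B \ s₃.X, z ∉ (B \ s₃.X) ∩ nbr H x :=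
      Finset.exists_mem_notMem_of_card_lt_card (by omega)
    have hzC : z ∈ C := hC'C (Finset.mem_of_mem_erase (Finset.mem_sdiff.1 hz).1)
    have hadj : G.Adj x z := by
      rcases P.adj_or x z (fun h => hWC x hxW (h ▸ hzC)) with h | h
      · exact h
      · exact absurd (Finset.mem_inter.2 ⟨hz, mem_nbr.2 h⟩) hzx
    rw [← hBlabel z hz]
    exact s₃.eq_of_adj x (Finset.mem_sdiff.2 ⟨hxa, hxX⟩) z (hBT hz) hadj
  have hfin := s₃.card_le_of_one_label (A := B ∪ (W ∩ nbr G a))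
    (Finset.union_subset hBa Finset.inter_subset_right) (s₃.f p) (by
      intro x hx hxX
      rcases Finset.mem_union.1 hx with h | h
      · exact hBlabel x (Finset.mem_sdiff.2 ⟨h, hxX⟩)
      · exact hWlabel x h hxX)
  have hdisj : Disjoint B (W ∩ nbr G a) := by
    rw [Finset.disjoint_left]
    intro x hx hx'
    exact hWC x (Finset.mem_inter.1 hx').1 (hC'C (Finset.mem_of_mem_erase hx))
  rw [Finset.card_union_of_disjoint hdisj] at hfin
  have hWsplit : W.card ≤ (W ∩ nbr G a).card + (W ∩ nbr H a).card := by
    refine le_trans (Finset.card_le_card fun x hx => ?_) (Finset.card_union_le _ _)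
    rcases P.adj_or a x (fun h => hWC x hx (h ▸ hC'C haC')) with h | h
    · exact Finset.mem_union_left _ (Finset.mem_inter.2 ⟨hx, mem_nbr.2 h⟩)
    · exact Finset.mem_union_right _ (Finset.mem_inter.2 ⟨hx, mem_nbr.2 h⟩)
  generalize (W ∩ nbr H a).card = μ at *
  have e1 : 3 * n + 53 ≤ 4 * S.card := by omega
  have e2 : 3 * n + 13 ≤ 4 * W.card := by omega
  have e3 : 2 * W.card + 7 ≤ 2 * μ + n := by omega
  exact averaging_bound e1 e2 e3 haW

/-- One of two complementary graphs without fans has a large clique. -/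
theorem exists_large_clique (P : ComplPair G H n) [Nonempty V]
    (hN : 11 * n + 11 ≤ 2 * Fintype.card V) (hN' : 2 * Fintype.card V ≤ 11 * n + 12) :
    (∃ R : Finset V, G.IsClique (R : Set V) ∧ 3 * n ≤ 2 * R.card) ∨
    (∃ R : Finset V, H.IsClique (R : Set V) ∧ 3 * n ≤ 2 * R.card) := by
  by_contra hcon
  push Not at hcon
  obtain ⟨v⟩ := ‹Nonempty V›
  have h := P.card_nbr_add v
  rcases Nat.lt_or_ge (4 * (nbr G v).card) (11 * n + 9) with h1 | h1
  · exact P.symm.not_large_degree_of_no_large_clique hN hN' hcon.2 hcon.1 (v := v) (by omega)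
  · exact P.not_large_degree_of_no_large_clique hN hN' hcon.1 hcon.2 h1

end ComplPair

/-! ### Excluding a large clique -/

/-- Double counting with weights `1 / b t`: sets `D u ⊆ P` that are large compared with the
multiplicities `b t` of their elements. -/
theorem card_mul_le_of_multiplicity {V : Type*} [DecidableEq V] (Q P : Finset V)
    (D : V → Finset V) (b : V → ℕ) (a β : ℕ) (hD : ∀ u ∈ Q, D u ⊆ P)
    (hb : ∀ t, (Q.filter fun u => t ∈ D u).card ≤ b t) (hβ : ∀ u ∈ Q, ∀ t ∈ D u, b t ≤ β)
    (ha : ∀ u ∈ Q, ∀ t ∈ D u, a + b t ≤ (D u).card) (hne : ∀ u ∈ Q, (D u).Nonempty) :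
    Q.card * (β + a) ≤ β * P.card := by
  rcases Q.eq_empty_or_nonempty with rfl | ⟨u₀, hu₀⟩
  · simp
  have hpos : ∀ u ∈ Q, ∀ t ∈ D u, 0 < b t := fun u hu t ht =>
    lt_of_lt_of_le (Finset.card_pos.2 ⟨u, Finset.mem_filter.2 ⟨hu, ht⟩⟩) (hb t)
  obtain ⟨t₀, ht₀⟩ := hne u₀ hu₀
  have hβpos : 0 < β := lt_of_lt_of_le (hpos _ hu₀ _ ht₀) (hβ _ hu₀ _ ht₀)
  have hβq : (0 : ℚ) < β := by exact_mod_cast hβpos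
  -- Where `b` is maximal on `D u`, the ratio `(a + b t₁) / b t₁` is at least `(a + β) / β`, and the
  -- weight of `D u` is no smaller.
  have h1 : ∀ u ∈ Q, ((β : ℚ) + a) / β ≤ ∑ t ∈ D u, (1 : ℚ) / b t := by
    intro u hu
    obtain ⟨t₁, ht₁, hmax⟩ := Finset.exists_max_image (D u) b (hne u hu)
    have hη : (0 : ℚ) < b t₁ := by exact_mod_cast hpos u hu t₁ ht₁
    have h2 : ((D u).card : ℚ) * (1 / b t₁) ≤ ∑ t ∈ D u, (1 : ℚ) / b t := by
      rw [← nsmul_eq_mul]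
      refine Finset.card_nsmul_le_sum _ _ _ fun t ht => ?_
      have : (0 : ℚ) < b t := by exact_mod_cast hpos u hu t ht
      exact one_div_le_one_div_of_le this (by exact_mod_cast hmax t ht)
    refine le_trans ?_ h2
    have h3 : ((a : ℚ) + b t₁) ≤ (D u).card := by exact_mod_cast ha u hu t₁ ht₁
    have h4 : (b t₁ : ℚ) ≤ β := by exact_mod_cast hβ u hu t₁ ht₁
    have h5 : (0 : ℚ) ≤ a := by positivity
    rw [mul_one_div, div_le_div_iff₀ hβq hη]
    nlinarith
  have h2 : ∑ u ∈ Q, ∑ t ∈ D u, (1 : ℚ) / b t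
      = ∑ t ∈ P, ∑ u ∈ Q.filter (fun u => t ∈ D u), (1 : ℚ) / b t := by
    refine Finset.sum_comm' fun u t => ?_
    simp only [Finset.mem_filter]
    exact ⟨fun h => ⟨h, hD u h.1 h.2⟩, fun h => h.1⟩
  have h3 : ∑ t ∈ P, ∑ u ∈ Q.filter (fun u => t ∈ D u), (1 : ℚ) / b t ≤ P.card := by
    have : (P.card : ℚ) = ∑ t ∈ P, (1 : ℚ) := by simp
    rw [this]
    refine Finset.sum_le_sum fun t _ => ?_
    rw [Finset.sum_const, nsmul_eq_mul, mul_one_div]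
    exact div_le_one_of_le₀ (by exact_mod_cast hb t) (by positivity)
  have h4 : (Q.card : ℚ) * (((β : ℚ) + a) / β) ≤ ∑ u ∈ Q, ∑ t ∈ D u, (1 : ℚ) / b t := by
    rw [← nsmul_eq_mul]
    exact Finset.card_nsmul_le_sum _ _ _ h1
  have h5 : (Q.card : ℚ) * (((β : ℚ) + a) / β) ≤ P.card := by
    rw [h2] at h4
    exact h4.trans h3
  rw [mul_div_assoc', div_le_iff₀ hβq] at h5
  have h6 : Q.card * (β + a) ≤ P.card * β := by exact_mod_cast h5
  rwa [mul_comm P.card] at h6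

/-- The count reads `m * a ≤ β * (p - m)`, where `m ≥ 3n/2`, `a` is at least about `n/2` and `p - m`
at most about `5n/2`; the quotient is `3n/10`. -/
theorem max_multiplicity_bound {n N m β a : ℕ} (hn : 0 < n) (hN : 11 * n + 11 ≤ 2 * N)
    (hN' : 2 * N ≤ 11 * n + 12) (hm : 3 * n ≤ 2 * m) (ha : a + 5 * n = N) {p : ℕ} (hp : p + m = N)
    (h : m * (β + a) ≤ β * p) : 3 * n ≤ 10 * β := by
  by_contra hlt
  push Not at hlt
  have h1 : m * a ≤ β * (p - m) := by
    rw [Nat.mul_sub, mul_comm β m]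
    rw [mul_add] at h
    omega
  have h2 : 2 * (p - m) ≤ 5 * n + 12 := by omega
  have h3 : β * (2 * (p - m)) ≤ β * (5 * n + 12) := Nat.mul_le_mul_left _ h2
  have h4 : (3 * n) * (n + 11) ≤ (2 * m) * (2 * a) := Nat.mul_le_mul hm (by omega)
  have h5 : 10 * β * (5 * n + 12) ≤ 3 * n * (5 * n + 12) := Nat.mul_le_mul_right _ hlt.le
  nlinarith

/-- All quantities are compared with `F = β + y₀ + n - 1 - y`, which is at least `β ≥ 3n/10`: one
has `Ξ ≤ Z`, `p ≤ 4n - 1 - F` and `q ≥ m - 2F + β ≥ 9n/5 - 2F`, with `Z ≤ n/2 - F`. The count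
becomes `q * (n - F) ≤ Z * (4n - 1 - F)`, and hence `14nF + 20F² ≤ 4n²`, false for `F ≥ 3n/10`. -/
theorem final_count_bound {n N m β a y₀ y e τ q Ξ p : ℤ} (hn : 0 < n) (hN : 11 * n + 11 ≤ 2 * N)
    (hm : 3 * n ≤ 2 * m) (ha : a + 5 * n = N)
    (hβ : 3 * n ≤ 10 * β) (hy₀ : 0 ≤ y₀) (hy : y + 1 ≤ n) (he : N ≤ e + 3 * n)
    (hτ : τ + m + y = e + β + y₀) (hΞ : Ξ + m + τ = 2 * n + 1) (hΞ1 : 1 ≤ Ξ)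
    (hp : p + m + τ = N) (hq : m + 2 + 2 * y ≤ q + β + y₀ + 2 * n)
    (h : q * (Ξ + a) ≤ Ξ * p) : False := by
  obtain ⟨F, hF⟩ : ∃ F, F = β + y₀ + n - 1 - y := ⟨_, rfl⟩
  obtain ⟨Z, hZ⟩ : ∃ Z, Z = 6 * n - N - F := ⟨_, rfl⟩
  have hFβ : β ≤ F := by omega
  have hΞZ : Ξ ≤ Z := by omega
  have hpF : p ≤ 4 * n - 1 - F := by omega
  have hq' : m - 2 * F + β ≤ q := by omega
  have hqpos : 0 ≤ q := by omega
  have hapos : 0 ≤ a := by omega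
  have hqp : q ≤ p := by
    by_contra hlt
    push Not at hlt
    have h1 : 0 ≤ q * a := mul_nonneg hqpos hapos
    nlinarith
  have h1 : q * a ≤ Z * (4 * n - 1 - F - q) := by
    have h2 : Ξ * (p - q) ≤ Z * (p - q) := mul_le_mul_of_nonneg_right hΞZ (by omega)
    have h3 : Z * (p - q) ≤ Z * (4 * n - 1 - F - q) := mul_le_mul_of_nonneg_left (by omega) (by omega)
    nlinarith
  have h2 : q * (n - F) ≤ Z * (4 * n - 1 - F) := by
    have : a = n - F - Z := by omega
    rw [this] at h1
    nlinarith
  have h3 : (36 * n - 40 * F) * (n - F) ≤ 20 * q * (n - F) :=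
    mul_le_mul_of_nonneg_right (by omega) (by omega)
  have h4 : 2 * Z * (4 * n - 1 - F) ≤ (n - 2 * F) * (4 * n - 1 - F) :=
    mul_le_mul_of_nonneg_right (by omega) (by omega)
  have h5 : (n - 2 * F) * (4 * n - 1 - F) ≤ (n - 2 * F) * (4 * n - F) :=
    mul_le_mul_of_nonneg_left (by omega) (by omega)
  have h6 : 3 * n ≤ 10 * F := by omega
  have h7 : 3 * n * n ≤ 10 * F * n := mul_le_mul_of_nonneg_right h6 hn.le
  have h8 : 0 ≤ F * F := mul_self_nonneg F
  nlinarith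

namespace ComplPair

variable {V : Type*} [Fintype V] [DecidableEq V] {G H : SimpleGraph V} {n : ℕ}

/-- For a vertex `u` of a large clique `Q` of `G` there is a small set `X` and a large set `D` of
neighbours of `u` that are joined to `Q \ X` only in the complementary graph. -/
theorem exists_far (P : ComplPair G H n) {Q : Finset V} (hQ : G.IsClique (Q : Set V))
    (hQn : 3 * n ≤ 2 * Q.card) {u : V} (hu : u ∈ Q) :
    ∃ X D : Finset V, D ⊆ nbr G u ∧ Disjoint D Q ∧
      (∀ t ∈ D, ∀ q ∈ Q, q ≠ u → q ∉ X → H.Adj t q) ∧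
      (nbr G u).card + X.card + 1 ≤ D.card + 2 * n ∧
      (∀ t ∈ D, ∃ Z ⊆ D, (∀ z ∈ Z, H.Adj t z) ∧ (nbr G u).card + X.card ≤ Z.card + 2 * n) ∧
      (∀ L ⊆ nbr G u, Disjoint L Q →
        (∀ l ∈ L, l ∉ X → ∃ q ∈ Q, q ≠ u ∧ q ∉ X ∧ G.Adj l q) →
        Disjoint L D ∧ X.card + Q.card + L.card ≤ 2 * n) := by
  obtain ⟨s⟩ := P.split_left u
  have hX := s.card_X_lt
  have hk := s.le_k
  have hQu : Q.erase u ⊆ nbr G u := by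
    intro a ha
    obtain ⟨h1, h2⟩ := Finset.mem_erase.1 ha
    exact mem_nbr.2 (hQ hu h2 h1.symm)
  obtain ⟨q₀, hq₀, hq₀X⟩ : ∃ q ∈ Q, q ∉ insert u s.X :=
    Finset.exists_mem_notMem_of_card_lt_card (by
      have := Finset.card_insert_le u s.X
      omega)
  rw [Finset.mem_insert, not_or] at hq₀X
  have hmemT : ∀ q ∈ Q, q ≠ u → q ∉ s.X → q ∈ s.T := fun q h1 h2 h3 =>
    Finset.mem_sdiff.2 ⟨hQu (Finset.mem_erase.2 ⟨h2, h1⟩), h3⟩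
  have hlabel : ∀ q ∈ Q, q ≠ u → q ∉ s.X → s.f q = s.f q₀ := by
    intro q h1 h2 h3
    by_cases h : q = q₀
    · rw [h]
    · exact s.eq_of_adj q (hmemT q h1 h2 h3) q₀ (hmemT q₀ hq₀ hq₀X.1 hq₀X.2) (hQ h1 hq₀ h)
  -- What survives of `Q` outside `s.X` carries the single label of `q₀`; `D` consists of the
  -- vertices with another label.
  set D := s.T.filter fun a => s.f a ≠ s.f q₀ with hD
  have hDsub : D ⊆ nbr G u := (Finset.filter_subset _ _).trans Finset.sdiff_subset
  refine ⟨s.X, D, hDsub, ?_, ?_, ?_, ?_, ?_⟩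
  · rw [Finset.disjoint_left]
    intro t ht htQ
    obtain ⟨h1, h2⟩ := Finset.mem_filter.1 ht
    obtain ⟨h3, h4⟩ := s.mem_T.1 h1
    exact h2 (hlabel t htQ h3.ne' h4)
  · intro t ht q hq hqu hqX
    obtain ⟨h1, h2⟩ := Finset.mem_filter.1 ht
    exact P.adj_of_ne_label s h1 (hmemT q hq hqu hqX) (by rwa [hlabel q hq hqu hqX])
  · have : s.k ≤ D.card + 1 := s.k_le_filter (s.f q₀)
    omega
  · intro t ht
    refine ⟨s.T.filter fun a => s.f a ≠ s.f q₀ ∧ s.f a ≠ s.f t, ?_, ?_, ?_⟩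
    · intro a ha
      obtain ⟨h1, h2, -⟩ := Finset.mem_filter.1 ha
      exact Finset.mem_filter.2 ⟨h1, h2⟩
    · intro z hz
      obtain ⟨h1, -, h3⟩ := Finset.mem_filter.1 hz
      exact P.adj_of_ne_label s (Finset.mem_filter.1 ht).1 h1 h3.symm
    · have := s.k_le_filter_filter (s.f q₀) (s.f t)
      omega
  · intro L hL hLQ hLadj
    have hLlabel : ∀ l ∈ L, l ∉ s.X → s.f l = s.f q₀ := by
      intro l hl hlX
      obtain ⟨q, hq, hqu, hqX, hlq⟩ := hLadj l hl hlX
      rw [← hlabel q hq hqu hqX]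
      exact s.eq_of_adj l (Finset.mem_sdiff.2 ⟨hL hl, hlX⟩) q (hmemT q hq hqu hqX) hlq
    constructor
    · rw [Finset.disjoint_left]
      intro l hl hlD
      obtain ⟨h1, h2⟩ := Finset.mem_filter.1 hlD
      exact h2 (hLlabel l hl (s.mem_T.1 h1).2)
    · have h1 := s.card_le_of_one_label (A := Q.erase u ∪ L) (Finset.union_subset hQu hL)
        (s.f q₀) (by
          intro a ha haX
          rcases Finset.mem_union.1 ha with h | h
          · exact hlabel a (Finset.mem_of_mem_erase h) (Finset.ne_of_mem_erase h) haX
          · exact hLlabel a h haX)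
      rw [Finset.card_union_of_disjoint
        (Finset.disjoint_of_subset_left (Finset.erase_subset _ _) hLQ.symm)] at h1
      have h2 := Finset.card_erase_add_one hu
      omega

/-- A maximum clique is too small for a vertex `z` outside the removed set to be joined to all of
`A` in `H`. -/
theorem subset_X_of_max_clique (P : ComplPair G H n) {Q A Z : Finset V}
    (hmax : ∀ R : Finset V, G.IsClique (R : Set V) → R.card ≤ Q.card)
    (hA : G.IsClique (A : Set V)) {t : V} (s : NbrSplit H n t) (hAt : A ⊆ nbr H t)
    (hZt : Z ⊆ nbr H t) (hAZ : ∀ z ∈ Z, ∀ q ∈ A, H.Adj z q)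
    (hcard : Q.card + 2 * n ≤ (nbr H t).card + A.card) : Z ⊆ s.X := by
  intro z hz
  by_contra hzX
  have hzT : z ∈ s.T := Finset.mem_sdiff.2 ⟨hZt hz, hzX⟩
  have hAT : A \ s.X ⊆ s.T := Finset.sdiff_subset_sdiff hAt le_rfl
  have hAlabel : ∀ q ∈ A \ s.X, s.f q = s.f z := fun q hq =>
    (s.eq_of_adj z hzT q (hAT hq) (hAZ z hz q (Finset.mem_sdiff.1 hq).1)).symm
  -- If `z` survives, so does its label on `A \ s.X`. Representatives of the other labels are
  -- `G`-joined to `A \ s.X`, and the union is a clique larger than `Q`.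
  obtain ⟨R, hRsub, hR, hRcard⟩ := P.symm.exists_clique s
    (Finset.filter_subset (fun a => s.f a ≠ s.f z) s.T)
  have hRT : ∀ r ∈ R, r ∈ s.T ∧ s.f r ≠ s.f z := fun r hr => Finset.mem_filter.1 (hRsub hr)
  have hRA : ∀ r ∈ R, ∀ q ∈ A \ s.X, G.Adj r q := fun r hr q hq =>
    P.symm.adj_of_ne_label s (hRT r hr).1 (hAT hq) (by rw [hAlabel q hq]; exact (hRT r hr).2)
  have hdisj : Disjoint R (A \ s.X) := by
    rw [Finset.disjoint_left]
    exact fun r hr hrA => (hRT r hr).2 (hAlabel r hrA)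
  have hclique : G.IsClique ((R ∪ (A \ s.X) : Finset V) : Set V) := by
    intro a ha b hb hab
    rw [Finset.mem_coe, Finset.mem_union] at ha hb
    rcases ha with ha | ha <;> rcases hb with hb | hb
    · exact hR ha hb hab
    · exact hRA a ha b hb
    · exact (hRA b hb a ha).symm
    · exact hA (Finset.mem_sdiff.1 ha).1 (Finset.mem_sdiff.1 hb).1 hab
  have h1 := hmax _ hclique
  rw [Finset.card_union_of_disjoint hdisj] at h1
  have h2 := s.le_k
  have h3 := s.k_le_image_filter (s.f z)
  have h4 := Finset.card_sdiff_add_card A s.X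
  have h5 := Finset.card_le_card (Finset.subset_union_left (s₁ := A) (s₂ := s.X))
  omega

/-- Complementary graphs without fans have no clique of size `3 * n / 2` on about `11 * n / 2`
vertices. -/
theorem not_large_clique (P : ComplPair G H n) (hn : 0 < n)
    (hN : 11 * n + 11 ≤ 2 * Fintype.card V) (hN' : 2 * Fintype.card V ≤ 11 * n + 12)
    {Q : Finset V} (hQ : G.IsClique (Q : Set V)) (hQn : 3 * n ≤ 2 * Q.card)
    (hmax : ∀ R : Finset V, G.IsClique (R : Set V) → R.card ≤ Q.card) : False := by
  classical
  have hfar := fun u (hu : u ∈ Q) => P.exists_far hQ hQn hu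
  choose! X D hDsub hDQ hDadj hDcard hDZ hDL using hfar
  -- `a = N - 5n` is the excess of `D u` over `b`: degrees are at least `N - 3n`, `D u` has at least
  -- `deg u + |X u| + 1 - 2n` vertices, and `b t ≤ |X u| + 1` on `D u`.
  obtain ⟨a, ha⟩ : ∃ a, a + 5 * n = Fintype.card V := ⟨Fintype.card V - 5 * n, by omega⟩
  have hXQ : ∀ u ∈ Q, (X u).card + Q.card ≤ 2 * n := by
    intro u hu
    simpa using (hDL u hu ∅ (by simp) (by simp) (by simp)).2
  have hdeg := P.le_card_nbr
  have hdegH := P.symm.le_card_nbr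
  let b : V → ℕ := fun t => (Q ∩ nbr G t).card
  have hbX : ∀ u ∈ Q, ∀ t ∈ D u, b t ≤ (X u).card + 1 := by
    intro u hu t ht
    refine (Finset.card_le_card (fun q hq => ?_)).trans (Finset.card_insert_le u (X u))
    obtain ⟨h1, h2⟩ := Finset.mem_inter.1 hq
    rw [Finset.mem_insert]
    by_contra hcon
    push Not at hcon
    exact P.not_both _ _ (mem_nbr.1 h2) (hDadj u hu t ht q h1 hcon.1 hcon.2)
  have hDa : ∀ u ∈ Q, ∀ t ∈ D u, a + b t ≤ (D u).card := by
    intro u hu t ht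
    have h1 := hDcard u hu
    have h2 := hbX u hu t ht
    have h3 := hdeg u
    omega
  have hDne : ∀ u ∈ Q, (D u).Nonempty := by
    intro u hu
    have h1 := hDcard u hu
    have h3 := hdeg u
    exact Finset.card_pos.1 (by omega)
  have hmult : ∀ Q' ⊆ Q, ∀ t, (Q'.filter fun u => t ∈ D u).card ≤ b t := by
    intro Q' hQ' t
    refine Finset.card_le_card fun u hu => ?_
    obtain ⟨h1, h2⟩ := Finset.mem_filter.1 hu
    have h3 := hDsub u (hQ' h1) h2
    exact Finset.mem_inter.2 ⟨hQ' h1, mem_nbr.2 (mem_nbr.1 h3).symm⟩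
  -- a vertex of maximum multiplicity
  obtain ⟨u₀, hu₀⟩ : Q.Nonempty := Finset.card_pos.1 (by omega)
  obtain ⟨t, htU, htmax⟩ := Finset.exists_max_image (Q.biUnion D) b
    ((hDne u₀ hu₀).mono (Finset.subset_biUnion_of_mem D hu₀))
  obtain ⟨u, hu, htu⟩ := Finset.mem_biUnion.1 htU
  have hβ : 3 * n ≤ 10 * b t := by
    refine max_multiplicity_bound hn hN hN' hQn ha (p := Qᶜ.card) ?_
      (card_mul_le_of_multiplicity Q Qᶜ D b a (b t) ?_ (hmult Q le_rfl) ?_ hDa hDne)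
    · rw [add_comm, Finset.card_add_card_compl]
    · intro u hu x hx
      exact Finset.mem_compl.2 (Finset.disjoint_left.1 (hDQ u hu) hx)
    · exact fun u hu x hx => htmax x (Finset.mem_biUnion.2 ⟨u, hu, hx⟩)
  have htQ : t ∉ Q := Finset.disjoint_left.1 (hDQ u hu) htu
  have hxu := hXQ u hu
  have hbu := hbX u hu t htu
  -- the neighbourhood of `t` in `H`
  obtain ⟨s⟩ := P.split_right t
  obtain ⟨Z, hZD, hZt, hZcard⟩ := hDZ u hu t htu
  have hZX : Z ⊆ s.X := by
    refine P.subset_X_of_max_clique hmax (A := (Q.erase u) \ X u) ?_ s ?_ ?_ ?_ ?_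
    · exact hQ.subset (by
        intro x hx
        exact Finset.mem_of_mem_erase (Finset.mem_sdiff.1 hx).1)
    · intro q hq
      obtain ⟨h1, h2⟩ := Finset.mem_sdiff.1 hq
      obtain ⟨h3, h4⟩ := Finset.mem_erase.1 h1
      exact mem_nbr.2 (hDadj u hu t htu q h4 h3 h2)
    · exact fun z hz => mem_nbr.2 (hZt z hz)
    · intro z hz q hq
      obtain ⟨h1, h2⟩ := Finset.mem_sdiff.1 hq
      obtain ⟨h3, h4⟩ := Finset.mem_erase.1 h1
      exact hDadj u hu z (hZD hz) q h4 h3 h2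
    · have h1 := Finset.card_sdiff_add_card (Q.erase u) (X u)
      have h2 := Finset.card_le_card (Finset.subset_union_left (s₁ := Q.erase u) (s₂ := X u))
      have h3 := Finset.card_erase_add_one hu
      have h4 := hdegH t
      omega
  have hXcard : Z.card + (Q ∩ s.X).card ≤ s.X.card := by
    rw [← Finset.card_union_of_disjoint
      (Finset.disjoint_of_subset_left hZD ((hDQ u hu).mono_right Finset.inter_subset_left))]
    exact Finset.card_le_card (Finset.union_subset hZX Finset.inter_subset_right)
  have hQsplit : Q.card = b t + (Q ∩ s.T).card + (Q ∩ s.X).card := by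
    have h1 : Q = (Q ∩ nbr G t) ∪ (Q ∩ s.T) ∪ (Q ∩ s.X) := by
      ext q
      simp only [Finset.mem_union, Finset.mem_inter, NbrSplit.mem_T, mem_nbr]
      constructor
      · intro hq
        rcases P.adj_or t q (fun h => htQ (h ▸ hq)) with h | h
        · exact Or.inl (Or.inl ⟨hq, h⟩)
        · by_cases hqX : q ∈ s.X
          · exact Or.inr ⟨hq, hqX⟩
          · exact Or.inl (Or.inr ⟨hq, h, hqX⟩)
      · rintro ((h | h) | h) <;> exact h.1
    have h2 : Disjoint (Q ∩ nbr G t) (Q ∩ s.T) := by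
      rw [Finset.disjoint_left]
      intro q hq hq'
      exact P.not_both _ _ (mem_nbr.1 (Finset.mem_inter.1 hq).2)
        (s.mem_T.1 (Finset.mem_inter.1 hq').2).1
    have h3 : Disjoint ((Q ∩ nbr G t) ∪ (Q ∩ s.T)) (Q ∩ s.X) := by
      rw [Finset.disjoint_left]
      intro q hq hq'
      have hqX := (Finset.mem_inter.1 hq').2
      rcases Finset.mem_union.1 hq with h | h
      · exact P.not_both _ _ (mem_nbr.1 (Finset.mem_inter.1 h).2) (mem_nbr.1 (s.subset hqX))
      · exact (s.mem_T.1 (Finset.mem_inter.1 h).2).2 hqX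
    conv_lhs => rw [h1]
    rw [Finset.card_union_of_disjoint h3, Finset.card_union_of_disjoint h2]
  set L := s.T \ Q with hL
  have hLcard : L.card + (Q ∩ s.T).card = s.T.card := by
    rw [Finset.inter_comm]
    exact Finset.card_sdiff_add_card_inter s.T Q
  have hsT := s.card_T
  have hsk := s.le_k
  have hsX := s.card_X_lt
  -- the vertices of `Q ∩ s.T` sharing a label with a vertex outside `Q`
  set bad := (Q ∩ s.T).filter fun q => ∃ l ∈ L, s.f l = s.f q with hbad
  -- Discarding `bad` loses no label, since each of its labels also occurs on `L`.
  have hbadcard : s.k + bad.card ≤ s.T.card := by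
    have h1 : s.T.image s.f ⊆ (s.T \ bad).image s.f := by
      intro y hy
      obtain ⟨x, hx, rfl⟩ := Finset.mem_image.1 hy
      by_cases hxb : x ∈ bad
      · obtain ⟨-, l, hl, hlx⟩ := Finset.mem_filter.1 hxb
        rw [← hlx]
        refine Finset.mem_image_of_mem _ (Finset.mem_sdiff.2 ⟨(Finset.mem_sdiff.1 hl).1, ?_⟩)
        intro hlb
        exact (Finset.mem_sdiff.1 hl).2 (Finset.mem_inter.1 (Finset.mem_filter.1 hlb).1).1
      · exact Finset.mem_image_of_mem _ (Finset.mem_sdiff.2 ⟨hx, hxb⟩)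
    have h2 := (Finset.card_le_card h1).trans Finset.card_image_le
    have h3 : bad ⊆ s.T := (Finset.filter_subset _ _).trans Finset.inter_subset_right
    have h4 := Finset.card_sdiff_add_card_eq_card h3
    have h5 : (s.T.image s.f).card = s.k := rfl
    omega
  set Q₀ := (Q ∩ s.T) \ bad with hQ₀
  have hQ₀card : Q₀.card + bad.card = (Q ∩ s.T).card :=
    Finset.card_sdiff_add_card_eq_card (Finset.filter_subset _ _)
  have hQ₀Q : Q₀ ⊆ Q := Finset.sdiff_subset.trans Finset.inter_subset_left
  have hdu := hdeg u
  have hdt := hdegH t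
  have hLadj : ∀ q ∈ Q₀, ∀ l ∈ L, G.Adj q l := by
    intro q hq l hl
    obtain ⟨h1, h2⟩ := Finset.mem_sdiff.1 hq
    refine P.symm.adj_of_ne_label s (Finset.mem_inter.1 h1).2 (Finset.mem_sdiff.1 hl).1 ?_
    exact fun h => h2 (Finset.mem_filter.2 ⟨h1, l, hl, h.symm⟩)
  have hLQ : Disjoint L Q := Finset.sdiff_disjoint
  have hfarL : ∀ q ∈ Q₀, Disjoint L (D q) ∧ (X q).card + Q.card + L.card ≤ 2 * n := by
    intro q hq
    refine hDL q (hQ₀Q hq) L (fun l hl => mem_nbr.2 (hLadj q hq l hl)) hLQ ?_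
    intro l hl _
    have h1 := hXQ q (hQ₀Q hq)
    have h2 := Finset.card_insert_le q (X q)
    obtain ⟨r, hr, hrX⟩ : ∃ r ∈ Q₀, r ∉ insert q (X q) :=
      Finset.exists_mem_notMem_of_card_lt_card (by omega)
    rw [Finset.mem_insert, not_or] at hrX
    exact ⟨r, hQ₀Q hr, hrX.1, hrX.2, (hLadj r hr l hl).symm⟩
  obtain ⟨q₁, hq₁⟩ : Q₀.Nonempty := Finset.card_pos.1 (by omega)
  have hτ := (hfarL q₁ hq₁).2
  -- For `q` in `Q₀`, all of `L` shares the label of the clique at `q`. So `L` avoids `D q`, and the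
  -- multiplicities on `D q` are at most `|X q| + 1 ≤ Ξ`: the count is repeated outside `Q ∪ L` with
  -- `Ξ` in place of `b t`.
  obtain ⟨Ξ, hΞ⟩ : ∃ Ξ, Ξ + Q.card + L.card = 2 * n + 1 :=
    ⟨2 * n + 1 - Q.card - L.card, by omega⟩
  have hcount := card_mul_le_of_multiplicity Q₀ (Q ∪ L)ᶜ D b a Ξ
    (by
      intro q hq x hx
      rw [Finset.mem_compl, Finset.mem_union, not_or]
      exact ⟨Finset.disjoint_left.1 (hDQ q (hQ₀Q hq)) hx,
        Finset.disjoint_right.1 (hfarL q hq).1 hx⟩)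
    (hmult Q₀ hQ₀Q)
    (by
      intro q hq x hx
      have h1 := hbX q (hQ₀Q hq) x hx
      have h2 := (hfarL q hq).2
      omega)
    (fun q hq => hDa q (hQ₀Q hq)) (fun q hq => hDne q (hQ₀Q hq))
  have hPcard : (Q ∪ L)ᶜ.card + Q.card + L.card = Fintype.card V := by
    have h1 := Finset.card_add_card_compl (Q ∪ L)
    rw [Finset.card_union_of_disjoint hLQ.symm] at h1
    omega
  exact final_count_bound (n := n) (N := Fintype.card V) (m := Q.card) (β := b t) (a := a)
    (y₀ := (Q ∩ s.X).card) (y := s.X.card) (e := (nbr H t).card) (τ := L.card) (q := Q₀.card)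
    (Ξ := Ξ) (p := (Q ∪ L)ᶜ.card) (by omega) (by omega) (by omega) (by omega) (by omega)
    (by omega) (by omega) (by omega) (by omega) (by omega) (by omega) (by omega) (by omega)
    (by exact_mod_cast hcount)

/-- Complementary graphs without fans have fewer than `11 * n / 2 + 6` vertices. -/
theorem false_of_card (P : ComplPair G H n) (hn : 0 < n)
    (hN : 11 * n + 11 ≤ 2 * Fintype.card V) (hN' : 2 * Fintype.card V ≤ 11 * n + 12) : False := by
  classical
  have : Nonempty V := Fintype.card_pos_iff.1 (by omega)
  have key : ∀ {G H : SimpleGraph V}, ComplPair G H n →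
      ¬ ∃ R : Finset V, G.IsClique (R : Set V) ∧ 3 * n ≤ 2 * R.card := by
    rintro G H P ⟨R, hR, hRn⟩
    obtain ⟨Q, hQ, hmax⟩ := Finset.exists_max_image
      (Finset.univ.filter fun R : Finset V => G.IsClique (R : Set V)) Finset.card
      ⟨R, Finset.mem_filter.2 ⟨Finset.mem_univ _, hR⟩⟩
    have h1 := hmax R (Finset.mem_filter.2 ⟨Finset.mem_univ _, hR⟩)
    exact P.not_large_clique hn hN hN' (Finset.mem_filter.1 hQ).2 (by omega)
      fun S hS => hmax S (Finset.mem_filter.2 ⟨Finset.mem_univ _, hS⟩)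
  rcases P.exists_large_clique hN hN' with h | h
  · exact key P h
  · exact key P.symm h

end ComplPair

/-! ### The lower bound construction -/

/-- Vertices of the lower bound construction: three parts, each consisting of two halves of
size `m`. -/
abbrev PartVertex (m : ℕ) : Type := ZMod 3 × Bool × Fin m

/-- The arcs from the half `true` of part `i` to the half `false` of part `i + 1`; they form a
`d`-regular circulant bipartite graph. -/
def PartArc (m d : ℕ) [NeZero m] (v w : PartVertex m) : Prop :=
  w.1 = v.1 + 1 ∧ v.2.1 = true ∧ w.2.1 = false ∧ ((w.2.2 - v.2.2 : Fin m) : ℕ) < d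

/-- The graph whose three parts are cliques, with additional edges given by `PartArc`. -/
def partGraph (m d : ℕ) [NeZero m] : SimpleGraph (PartVertex m) where
  Adj v w := (v ≠ w ∧ v.1 = w.1) ∨ PartArc m d v w ∨ PartArc m d w v
  symm := ⟨fun _ _ h => by
    rcases h with h | h | h
    · exact Or.inl ⟨h.1.symm, h.2.symm⟩
    · exact Or.inr (Or.inr h)
    · exact Or.inr (Or.inl h)⟩
  loopless := ⟨fun v h => by
    rcases h with h | h | h
    · exact h.1 rfl
    · exact absurd (h.2.1.symm.trans h.2.2.1) (by simp)
    · exact absurd (h.2.1.symm.trans h.2.2.1) (by simp)⟩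

theorem card_part {m : ℕ} (j : ZMod 3) :
    (Finset.univ.filter fun w : PartVertex m => w.1 = j).card = 2 * m := by
  have h : (Finset.univ.filter fun w : PartVertex m => w.1 = j)
      = {j} ×ˢ (Finset.univ : Finset (Bool × Fin m)) := by
    ext ⟨i, w⟩
    simp only [Finset.mem_filter, Finset.mem_univ, true_and, Finset.mem_product,
      Finset.mem_singleton, and_true]
  rw [h, Finset.card_product]
  simp

section

variable {m d : ℕ} [NeZero m]

/-- The part containing the additional neighbours of `v`. -/
def thinPart (v : PartVertex m) : ZMod 3 := if v.2.1 then v.1 + 1 else v.1 - 1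

open Classical in
/-- The additional neighbours of `v`. -/
noncomputable def arcNbr (d : ℕ) (v : PartVertex m) : Finset (PartVertex m) :=
  Finset.univ.filter fun w => PartArc m d v w ∨ PartArc m d w v

theorem mem_arcNbr {v w : PartVertex m} :
    w ∈ arcNbr d v ↔ PartArc m d v w ∨ PartArc m d w v := by
  simp [arcNbr]

theorem card_arcNbr (hd : d ≤ m) (v : PartVertex m) : (arcNbr d v).card = d := by
  classical
  obtain ⟨i, a, x⟩ := v
  have hfin : (Finset.univ.filter fun z : Fin m => (z : ℕ) < d).card = d := by
    rw [Fin.card_filter_val_lt]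
    exact min_eq_right hd
  refine Eq.trans (Eq.symm ?_) hfin
  cases a
  · refine Finset.card_bij (fun z _ => (i - 1, true, x - z)) ?_ ?_ ?_
    · intro z hz
      simpa [mem_arcNbr, PartArc] using hz
    · intro z _ z' _ h
      simpa using h
    · rintro ⟨j, b, y⟩ h
      rw [mem_arcNbr] at h
      rcases h with ⟨-, h, -⟩ | ⟨h1, h2, -, h4⟩
      · simp at h
      · exact ⟨x - y, by simpa using h4, by
          dsimp only at h1 h2
          simp [h1, h2]⟩
  · refine Finset.card_bij (fun z _ => (i + 1, false, z + x)) ?_ ?_ ?_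
    · intro z hz
      simpa [mem_arcNbr, PartArc] using hz
    · intro z _ z' _ h
      simpa using h
    · rintro ⟨j, b, y⟩ h
      rw [mem_arcNbr] at h
      rcases h with ⟨h1, -, h2, h4⟩ | ⟨-, -, h, -⟩
      · exact ⟨y - x, by simpa using h4, by
          dsimp only at h1 h2
          simp [h1, h2]⟩
      · simp at h

theorem fst_eq_thinPart {v w : PartVertex m} (hw : w ∈ arcNbr d v) : w.1 = thinPart v := by
  rw [mem_arcNbr] at hw
  rcases hw with ⟨h1, h2, -⟩ | ⟨h1, -, h2, -⟩
  · simp [thinPart, h1, h2]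
  · simp [thinPart, h1, h2]

/-- Every degree is `2 * m - 1 + d`, less than the `2 * n` that the centre of a fan needs. -/
theorem not_fan_isContained_partGraph {n : ℕ} (hd : d ≤ m) (h : 2 * m + d ≤ 2 * n) :
    ¬ fan n ⊑ partGraph m d := by
  classical
  rintro ⟨φ⟩
  set v := φ none with hv
  have hmem : ∀ x, φ (some x) ∈ (Finset.univ.filter fun w : PartVertex m => w.1 = v.1).erase v
      ∪ arcNbr d v := by
    intro x
    have hadj : (partGraph m d).Adj v (φ (some x)) :=
      φ.toHom.map_adj (show (fan n).Adj none (some x) from ⟨by simp, Or.inl rfl⟩)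
    rcases hadj with h | h
    · refine Finset.mem_union_left _ (Finset.mem_erase.2 ⟨h.1.symm, ?_⟩)
      simpa using h.2.symm
    · exact Finset.mem_union_right _ (mem_arcNbr.2 h)
  have h1 := Finset.card_le_card_of_injOn (s := Finset.univ) (fun x => φ (some x))
    (fun x _ => hmem x) (fun x _ y _ hxy => Option.some_injective _ (φ.injective hxy))
  have h2 := h1.trans (Finset.card_union_le _ _)
  rw [card_arcNbr hd, Finset.card_erase_of_mem (by simp), card_part] at h2
  have h3 : 0 < m := Nat.pos_of_ne_zero (NeZero.ne m)
  simp at h2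
  omega

/-- The complement is tripartite, so each triangle at `v` has a vertex in `thinPart v`, where `v`
has only `2 * m - d < n` neighbours. -/
theorem not_fan_isContained_compl_partGraph {n : ℕ} (hd : d ≤ m) (h : 2 * m + 1 ≤ n + d) :
    ¬ fan n ⊑ (partGraph m d)ᶜ := by
  classical
  rintro ⟨φ⟩
  set v := φ none with hv
  set S := (Finset.univ.filter fun w : PartVertex m => w.1 = thinPart v) \ arcNbr d v with hS
  have hadj : ∀ x y, (fan n).Adj x y → (partGraph m d)ᶜ.Adj (φ x) (φ y) := fun x y h =>
    φ.toHom.map_adj h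
  have hpart : ∀ x y, (fan n).Adj x y → (φ x).1 ≠ (φ y).1 := by
    intro x y h h'
    have h1 := hadj x y h
    rw [SimpleGraph.compl_adj] at h1
    exact h1.2 (Or.inl ⟨h1.1, h'⟩)
  have hthree : ∀ i p q : ZMod 3, ∀ b : Bool, i ≠ p → i ≠ q → p ≠ q →
      p = (if b then i + 1 else i - 1) ∨ q = (if b then i + 1 else i - 1) := by decide
  have hmem : ∀ i, ∃ a : Fin 2, φ (some (i, a)) ∈ S := by
    intro i
    have hc : ∀ a, (fan n).Adj none (some (i, a)) := fun a => ⟨by simp, Or.inl rfl⟩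
    have he : (fan n).Adj (some (i, 0)) (some (i, 1)) :=
      ⟨by simp, Or.inr (Or.inr ⟨i, 0, 1, rfl, rfl⟩)⟩
    have hnot : ∀ a, φ (some (i, a)) ∉ arcNbr d v := by
      intro a ha
      have h1 := hadj _ _ (hc a)
      rw [SimpleGraph.compl_adj] at h1
      exact h1.2 (Or.inr (mem_arcNbr.1 ha))
    rcases hthree _ _ _ v.2.1 (hpart _ _ (hc 0)) (hpart _ _ (hc 1)) (hpart _ _ he) with h | h
    · exact ⟨0, Finset.mem_sdiff.2 ⟨Finset.mem_filter.2 ⟨Finset.mem_univ _, h⟩, hnot 0⟩⟩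
    · exact ⟨1, Finset.mem_sdiff.2 ⟨Finset.mem_filter.2 ⟨Finset.mem_univ _, h⟩, hnot 1⟩⟩
  choose a ha using hmem
  have h1 := Finset.card_le_card_of_injOn (s := Finset.univ) (fun i => φ (some (i, a i)))
    (fun i _ => ha i) (fun i _ j _ hij => by
      have := Option.some_injective _ (φ.injective hij)
      exact (Prod.ext_iff.1 this).1)
  have h2 : arcNbr d v ⊆ Finset.univ.filter fun w : PartVertex m => w.1 = thinPart v :=
    fun w hw => Finset.mem_filter.2 ⟨Finset.mem_univ _, fst_eq_thinPart hw⟩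
  have h3 := Finset.card_sdiff_add_card_eq_card h2
  rw [← hS, card_arcNbr hd, card_part] at h3
  simp only [Finset.card_univ, Fintype.card_fin] at h1
  omega

end

/-! ### Bounds on the Ramsey number -/

/-- Membership in `ramseySet` applies to graphs on every sufficiently large finite type. -/
theorem isContained_or_of_mem_ramseySet {α β γ : Type*} {H₁ : SimpleGraph α} {H₂ : SimpleGraph β}
    {N : ℕ} (hN : N ∈ ramseySet H₁ H₂) [Fintype γ] (hγ : N ≤ Fintype.card γ) (G : SimpleGraph γ) :
    H₁ ⊑ Gᶜ ∨ H₂ ⊑ G := by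
  classical
  obtain ⟨e⟩ : Nonempty (Fin N ↪ γ) := Function.Embedding.nonempty_of_card_le (by simpa using hγ)
  have h := hN (G.comap e).toTopEdgeLabeling
  rw [SimpleGraph.toTopEdgeLabeling_labelGraph, SimpleGraph.toTopEdgeLabeling_labelGraph_compl] at h
  refine h.imp (fun h => h.trans ⟨⟨⟨e, ?_⟩, e.injective⟩⟩) (fun h => h.trans ⟨⟨⟨e, ?_⟩, e.injective⟩⟩)
  · intro a b hab
    rw [SimpleGraph.compl_adj] at hab ⊢
    exact ⟨fun h => hab.1 (e.injective h), hab.2⟩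
  · exact fun h => h

/-- The complement needs `d ≥ 2 * m + 1 - n`. With equality, the degree condition `2 * m + d ≤ 2 *
n` becomes `4 * m + 1 ≤ 3 * n`, which gives the value of `m`. -/
theorem lt_of_mem_ramseySet_fan {n N : ℕ} (hn : 0 < n) (hN : N ∈ ramseySet (fan n) (fan n)) :
    6 * ((3 * n - 1) / 4) < N := by
  by_contra hlt
  push Not at hlt
  obtain ⟨m, hm⟩ : ∃ m, m = (3 * n - 1) / 4 := ⟨_, rfl⟩
  rcases Nat.eq_zero_or_pos m with h0 | hpos
  -- This happens only for `n = 1`; the claim is then `0 < N`, as no fan embeds in the empty graph.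
  · have hN0 : N ≤ Fintype.card (Fin 0) := by simp; omega
    rcases isContained_or_of_mem_ramseySet hN hN0 ⊥ with ⟨⟨φ⟩⟩ | ⟨⟨φ⟩⟩ <;> exact (φ none).elim0
  · have : NeZero m := ⟨hpos.ne'⟩
    have hcard : Fintype.card (PartVertex m) = 6 * m := by
      simp only [Fintype.card_prod, ZMod.card, Fintype.card_bool, Fintype.card_fin]
      ring
    rcases isContained_or_of_mem_ramseySet hN (by rw [hcard]; omega)
      (partGraph m (2 * m + 1 - n)) with h | h
    · exact not_fan_isContained_compl_partGraph (by omega) (by omega) h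
    · exact not_fan_isContained_partGraph (by omega) (by omega) h

/-- This is the only integer `N` with `11 * n + 11 ≤ 2 * N ≤ 11 * n + 12`. -/
theorem mem_ramseySet_fan {n : ℕ} (hn : 0 < n) :
    5 * n + n / 2 + 6 ∈ ramseySet (fan n) (fan n) := by
  intro C
  by_contra hcon
  rw [not_or] at hcon
  have P : ComplPair (C.labelGraph 0) (C.labelGraph 1) n := by
    refine ⟨fun a b hab => ?_, fun a b h0 h1 => ?_, nonempty_nbrSplit _ n hn hcon.1,
      nonempty_nbrSplit _ n hn hcon.2⟩
    · rw [SimpleGraph.TopEdgeLabeling.labelGraph_adj, SimpleGraph.TopEdgeLabeling.labelGraph_adj]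
      rcases Fin.exists_fin_two.1 ⟨C.get a b hab, rfl⟩ with h | h
      · exact Or.inl ⟨hab, h⟩
      · exact Or.inr ⟨hab, h⟩
    · rw [SimpleGraph.TopEdgeLabeling.labelGraph_adj] at h0 h1
      obtain ⟨_, h0⟩ := h0
      obtain ⟨_, h1⟩ := h1
      rw [h0] at h1
      exact absurd h1 (by decide)
  exact P.false_of_card hn (by simp; omega) (by simp; omega)

/-- The first conjunct says that the minimum defining `r(F_n)` exists. -/
theorem mainTheorem1 (n : ℕ) (hn : 0 < n) :
    IsLeast (ramseySet (fan n) (fan n)) (diagRamseyNumber (fan n)) ∧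
    9 * (n : ℝ) / 2 - 5 ≤ (diagRamseyNumber (fan n) : ℝ) ∧
    (diagRamseyNumber (fan n) : ℝ) ≤ 11 * (n : ℝ) / 2 + 6 := by
  have hmem : diagRamseyNumber (fan n) ∈ ramseySet (fan n) (fan n) :=
    Nat.sInf_mem ⟨_, mem_ramseySet_fan hn⟩
  have hle : diagRamseyNumber (fan n) ≤ 5 * n + n / 2 + 6 := Nat.sInf_le (mem_ramseySet_fan hn)
  have hlt := lt_of_mem_ramseySet_fan hn hmem
  refine ⟨⟨hmem, fun N hN => Nat.sInf_le hN⟩, ?_, ?_⟩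
  · have h : 9 * n ≤ 2 * diagRamseyNumber (fan n) + 10 := by omega
    have h' : (9 : ℝ) * n ≤ 2 * diagRamseyNumber (fan n) + 10 := by exact_mod_cast h
    linarith
  · have h : 2 * diagRamseyNumber (fan n) ≤ 11 * n + 12 := by omega
    have h' : (2 : ℝ) * diagRamseyNumber (fan n) ≤ 11 * n + 12 := by exact_mod_cast h
    linarith
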